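/- Let $\pi:\mathbb R^5\to\mathbb R$, $(x,a,b,c,d)\mapsto x$, be the bundle whose sections are the Abel equations $y'=a(x)y^3+b(x)y^2+c(x)y+d(x)$, and let $J^k(\pi)$ be its space of $k$-jets. The pseudogroup $G$ of local transformations $x\mapsto f(x)$, $y\mapsto g(x)y+h(x)$ ($f,g,h$ of class $C^\infty$, $f'\neq0$, $g\neq0$) acts on these equations and hence on $J^k(\pi)$. Put $$s_1=a,\qquad s_3=a'b-b'a+abc-\tfrac29b^3-3a^2d,\qquad s_5=a\frac{Ds_3}{Dx}-3s_3\Bigl(a'+ac-\tfrac13b^2\Bigr),$$ where $D/Dx$ is the total derivative. A point of $J^k(\pi)$, $k\ge1$, is called regular if $s_1s_3\ne0$ at it. A differential invariant of order $\le k$ on a set $U$ of regular points that is open in $J^k(\pi)$ is a $C^\infty$ function on $U$ that takes equal values at any two points of $U$ in the same $G$-orbit; when $U$ is not mentioned, it is the set of all regular points. Let $$J_1=\frac{s_5^3}{s_3^5},\qquad \nabla=\frac{s_1}{s_3^{2/3}}\frac{D}{Dx},$$ with real cube roots, so that $s_3^{2/3}=|s_3|^{2/3}$ and $J_1^{1/3}=s_5/s_3^{5/3}$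 is smooth at regular points. Then: 1. $\nabla$ is an invariant derivation (it commutes with the prolonged action of $G$). 2. The algebra of differential invariants is generated by $J_1$ and $\nabla$: the differential invariants are exactly the members of the smallest family of functions that contains $J_1$, is closed under $\nabla$ and under regarding a function of order $\le k$ as one of order $\le k+1$, and contains every function that is smooth on the regular points and is there a continuous function of finitely many members (for instance $J_1^{1/3}$). More precisely, let $n\ge0$, let $U\subset J^{n+1}(\pi)$ be an open set of regular points and let $I$ be a differential invariant of order $\le n+1$ on $U$. Then $I$ is a $C^\infty$ function of $J_1^{1/3},\nabla(J_1^{1/3}),\dots,\nabla^{n-1}(J_1^{1/3})$; and if $n=0$ or $J_1\neq0$ on $U$, then $I$ is a $C^\infty$ function of $J_1,\nabla J_1,\dots,\nabla^{n-1}J_1$. 3. This algebra separates regular orbits: two regular points of $J^k(\pi)$, $k\ge1$, lie in the same $G$-orbit if and only if every differential invariant of order $\le k$ takes the same value at both. -/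

import Mathlib

open scoped ContDiff Topology

namespace Abel

/-- The jet space `J^k(π)` of the bundle `π : ℝ⁵ → ℝ`, `(x, a, b, c, d) ↦ x`. A point is
`(x, u)`, where `u i j` is the fibre coordinate standing for the `j`-th derivative of the `i`-th
coefficient (`a, b, c, d` for `i = 0, 1, 2, 3`), `0 ≤ j ≤ k`. -/
abbrev Jet (k : ℕ) : Type := ℝ × (Fin 4 → Fin (k + 1) → ℝ)

/-- The projection `π_{k,l} : J^k(π) → J^l(π)`, `l ≤ k`. -/
def proj {k l : ℕ} (h : l ≤ k) (z : Jet k) : Jet l :=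
  (z.1, fun i j => z.2 i (Fin.castLE (Nat.succ_le_succ h) j))

/-- The `k`-jet at `x` of a section `s = (a, b, c, d)`. -/
noncomputable def jet (k : ℕ) (s : ℝ → Fin 4 → ℝ) (x : ℝ) : Jet k :=
  (x, fun i j => iteratedDeriv (j : ℕ) (fun t => s t i) x)

/-- The right-hand side `a y³ + b y² + c y + d` of an Abel equation. -/
def abel (u : Fin 4 → ℝ) (y : ℝ) : ℝ := u 0 * y ^ 3 + u 1 * y ^ 2 + u 2 * y + u 3

/-- `u` is of class `C^∞` on a neighbourhood of `x`. -/
def SmoothNear {E : Type*} [NormedAddCommGroup E] [NormedSpace ℝ E] (u : ℝ → E) (x : ℝ) : Prop :=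
  ∀ᶠ t in 𝓝 x, ContDiffAt ℝ ∞ u t

/-- The local transformation `x ↦ f(x)`, `y ↦ g(x) y + h(x)`, defined and invertible near the
line over `x₀`, sends the Abel equation with coefficients `s` near `x₀` to the Abel equation with
coefficients `s'` near `f x₀`: along `y' = a y³ + b y² + c y + d` the new variables satisfy
`d(g y + h)/dx = f' · (ã (g y + h)³ + b̃ (g y + h)² + c̃ (g y + h) + d̃)`, where the coefficients
`ã, b̃, c̃, d̃` are taken at `f(x)`. -/
structure Transforms (f g h : ℝ → ℝ) (s s' : ℝ → Fin 4 → ℝ) (x₀ : ℝ) : Prop where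
  smooth_f : SmoothNear f x₀
  smooth_g : SmoothNear g x₀
  smooth_h : SmoothNear h x₀
  smooth_source : SmoothNear s x₀
  smooth_target : SmoothNear s' (f x₀)
  deriv_ne : deriv f x₀ ≠ 0
  scale_ne : g x₀ ≠ 0
  equation : ∀ᶠ x in 𝓝 x₀, ∀ y : ℝ,
    deriv g x * y + g x * abel (s x) y + deriv h x
      = deriv f x * abel (s' (f x)) (g x * y + h x)

/-- Two `k`-jets lie in the same orbit of the prolonged action of the pseudogroup `G`: some
element of `G` sends some section with the first jet to a section with the second jet. -/
def SameOrbit {k : ℕ} (z z' : Jet k) : Prop :=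
  ∃ (f g h : ℝ → ℝ) (s s' : ℝ → Fin 4 → ℝ), Transforms f g h s s' z.1 ∧ f z.1 = z'.1 ∧
    jet k s z.1 = z ∧ jet k s' z'.1 = z'

/-- The total derivative `D/Dx = ∂/∂x + ∑ u_i^{(j+1)} ∂/∂u_i^{(j)}` of a function of order `k`;
the result is a function of order `k + 1`. -/
noncomputable def totalD {k : ℕ} (I : Jet k → ℝ) (z : Jet (k + 1)) : ℝ :=
  fderiv ℝ I (proj (Nat.le_succ k) z) ((1 : ℝ), fun i j => z.2 i j.succ)

/-- The relative invariant `s₁ = a`. -/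
def s1 {n : ℕ} (z : Jet (n + 1)) : ℝ := z.2 0 0

/-- The relative invariant `s₃ = a' b - b' a + a b c - (2/9) b³ - 3 a² d`. -/
noncomputable def s3 {n : ℕ} (z : Jet (n + 1)) : ℝ :=
  z.2 0 1 * z.2 1 0 - z.2 1 1 * z.2 0 0 + z.2 0 0 * z.2 1 0 * z.2 2 0
    - 2 / 9 * z.2 1 0 ^ 3 - 3 * z.2 0 0 ^ 2 * z.2 3 0

/-- The relative invariant `s₅ = a Ds₃/Dx - 3 s₃ (a' + a c - b²/3)`, of order `2`. -/
noncomputable def s5 (z : Jet 2) : ℝ :=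
  z.2 0 0 * totalD (k := 1) s3 z
    - 3 * s3 z * (z.2 0 1 + z.2 0 0 * z.2 2 0 - 1 / 3 * z.2 1 0 ^ 2)

/-- The set of regular points of `J^{n+1}(π)`: those with `s₁ s₃ ≠ 0`. -/
def Reg (n : ℕ) : Set (Jet (n + 1)) := {z | s1 z * s3 z ≠ 0}

/-- The absolute invariant `J₁ = s₅³ / s₃⁵`, of order `2`. -/
noncomputable def J1 (z : Jet (1 + 1)) : ℝ := s5 z ^ 3 / s3 z ^ 5

/-- The coefficient `s₁ / s₃^{2/3}`, where `s₃^{2/3}` is the square of the real cube root. -/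
noncomputable def coeff {n : ℕ} (z : Jet (n + 1)) : ℝ := s1 z / |s3 z| ^ (2 / 3 : ℝ)

/-- The derivation `∇ = (s₁ / s₃^{2/3}) D/Dx`, from functions of order `n + 1` to functions of
order `n + 2`. -/
noncomputable def nabla {n : ℕ} (I : Jet (n + 1) → ℝ) : Jet (n + 1 + 1) → ℝ :=
  fun z => coeff z * totalD I z

/-- The iterates `∇^i I` of a function `I` of order `m + 1`. -/
noncomputable def nablaIter {m : ℕ} (I : Jet (m + 1) → ℝ) : (i : ℕ) → Jet (m + i + 1) → ℝ
  | 0 => I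
  | i + 1 => nabla (nablaIter I i)

/-- `A · D/Dx` is invariant under the prolonged action of `G` (on regular points): if an element
of `G` over `x ↦ f(x)` sends `s` to `s'`, then applying `A D/Dx` to a function `I` and pulling
the result back by the transformation is the same as pulling `I` back and then applying
`A D/Dx`. -/
def IsInvariantDerivation (A : ∀ {n : ℕ}, Jet (n + 1) → ℝ) : Prop :=
  ∀ (f g h : ℝ → ℝ) (s s' : ℝ → Fin 4 → ℝ) (x : ℝ), Transforms f g h s s' x →
    ∀ (n : ℕ) (I : Jet (n + 1) → ℝ), ContDiffOn ℝ ∞ I (Reg n) →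
      jet (n + 1) s x ∈ Reg n →
      A (jet (n + 1 + 1) s' (f x)) * totalD I (jet (n + 1 + 1) s' (f x))
        = A (jet (n + 1 + 1) s x) * deriv (fun t => I (jet (n + 1) s' (f t))) x

/-- The differential invariants of order `≤ k` on a set `U` of `k`-jets: smooth functions that
are constant along the orbits of `G`. They form an algebra. -/
def invariants {k : ℕ} (U : Set (Jet k)) : Subalgebra ℝ (Jet k → ℝ) where
  carrier := {I | ContDiffOn ℝ ∞ I U ∧ ∀ z ∈ U, ∀ z' ∈ U, SameOrbit z z' → I z = I z'}
  mul_mem' := fun {I K} hI hK => ⟨hI.1.mul hK.1, fun z hz z' hz' h => by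
    simp only [Pi.mul_apply, hI.2 z hz z' hz' h, hK.2 z hz z' hz' h]⟩
  add_mem' := fun {I K} hI hK => ⟨hI.1.add hK.1, fun z hz z' hz' h => by
    simp only [Pi.add_apply, hI.2 z hz z' hz' h, hK.2 z hz z' hz' h]⟩
  algebraMap_mem' := fun _ => ⟨contDiffOn_const, fun _ _ _ _ _ => rfl⟩

/-- The functions generated by `J₁` and `∇` (on regular points): the smallest collection that
contains `J₁`, is closed under `∇` and under viewing a function of some order as a function of a
higher order, and is functionally closed, i.e. contains every smooth function on the regular
points that is a continuous function of finitely many members (in particular sums, products,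
constants, and `J₁^{1/3} = s₅ / s₃^{5/3}`). -/
inductive Generated : (n : ℕ) → (Jet (n + 1) → ℝ) → Prop
  | base : Generated 1 J1
  | nabla {n : ℕ} {I : Jet (n + 1) → ℝ} : Generated n I → Generated (n + 1) (nabla I)
  | lift {m n : ℕ} (h : m ≤ n) {I : Jet (m + 1) → ℝ} : Generated m I →
      Generated n (fun z => I (proj (Nat.succ_le_succ h) z))
  | comp {n p : ℕ} (I : Fin p → Jet (n + 1) → ℝ) (F : (Fin p → ℝ) → ℝ) (K : Jet (n + 1) → ℝ) :
      (∀ i, Generated n (I i)) → Continuous F → ContDiffOn ℝ ∞ K (Reg n) →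
      (∀ z ∈ Reg n, K z = F (fun i => I i z)) → Generated n K

/-- The real cube root. -/
noncomputable def cbrt (x : ℝ) : ℝ := Real.sign x * |x| ^ (1 / 3 : ℝ)

/-- The invariant `J₁^{1/3}`. -/
noncomputable def J1root (z : Jet (1 + 1)) : ℝ := cbrt (J1 z)

/-- The tuple `(I, ∇I, …, ∇^{n-1} I)` as functions on `J^{n+1}(π)`, for `I` of order `2`. -/
noncomputable def tower (I : Jet (1 + 1) → ℝ) {n : ℕ} (z : Jet (n + 1)) : Fin n → ℝ :=
  fun i => nablaIter I (i : ℕ) (proj (by omega) z)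

end Abel

/-! The expressions `s1`, `s3`, `s5` are relative invariants: their values at the source are those
at the target times f'g², (f'g)³, (f'g)⁵. Hence s₅³/s₃⁵ is invariant, and s₁/s₃^{2/3} picks up
exactly the factor that cancels the chain rule factor of D/Dx. The substance is completeness, proved
for the tower of `J1root`, which stays smooth where J₁ = 0.

The tower is triangular in the derivatives of d: ∇ⁱ(J₁^{1/3}) is free of d^{(j)} for j ≥ i + 2 and
affine in d^{(i+1)}, with a slope that does not vanish at regular points
(`nablaIter_J1root_add_three`). Two consequences carry the proof.

Separation of orbits: a regular germ can be brought to y' = y³ + φ(x) with φ(0) = -1/3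
(`exists_normalForm`). There the tower determines the derivatives of φ at 0 (`eq_of_tower_eq`), so
equal towers give normal forms with equal jets, and the remaining difference is absorbed by a
high-order change of d (`Transforms.exists_perturb`). A tower of length n reaches only φ^{(n)}, one
order short of an (n+1)-jet; `exists_lift` closes this gap, because b^{(n+2)} can be chosen freely.

Smoothness: solving the triangular system gives a smooth section σ of the tower through each regular
point (`exists_section_tower`), and an invariant I is locally (I ∘ σ) of the tower. Away from J₁ = 0
the chain rule passes from the tower of J₁^{1/3} to that of J₁. -/

namespace Abel

/-! ### Germs of smooth functions on the line -/

section SmoothNear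

variable {E : Type*} [NormedAddCommGroup E] [NormedSpace ℝ E] {u v : ℝ → ℝ} {x : ℝ}

theorem SmoothNear.self {w : ℝ → E} (h : SmoothNear w x) : ContDiffAt ℝ ∞ w x :=
  h.self_of_nhds

theorem SmoothNear.eventually {w : ℝ → E} (h : SmoothNear w x) : ∀ᶠ t in 𝓝 x, SmoothNear w t :=
  eventually_eventually_nhds.2 h

theorem SmoothNear.differentiableAt {w : ℝ → E} (h : SmoothNear w x) : DifferentiableAt ℝ w x :=
  h.self.differentiableAt (by simp)

theorem SmoothNear.hasDerivAt (h : SmoothNear u x) : HasDerivAt u (deriv u x) x :=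
  h.differentiableAt.hasDerivAt

theorem SmoothNear.deriv (h : SmoothNear u x) : SmoothNear (deriv u) x := by
  unfold SmoothNear at *
  filter_upwards [h] with t ht using ht.derivWithin (by simp)

theorem SmoothNear.iteratedDeriv (h : SmoothNear u x) (n : ℕ) :
    SmoothNear (iteratedDeriv n u) x := by
  induction n with
  | zero => simpa [iteratedDeriv_zero] using h
  | succ n ih => rw [iteratedDeriv_succ]; exact ih.deriv

theorem smoothNear_const (c : ℝ) : SmoothNear (fun _ : ℝ => c) x :=
  Filter.Eventually.of_forall fun _ => contDiffAt_const

theorem SmoothNear.mul (h : SmoothNear u x) (h' : SmoothNear v x) :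
    SmoothNear (fun t => u t * v t) x := by
  unfold SmoothNear at *
  filter_upwards [h, h'] with t ht ht' using ht.mul ht'

theorem SmoothNear.add (h : SmoothNear u x) (h' : SmoothNear v x) :
    SmoothNear (fun t => u t + v t) x := by
  unfold SmoothNear at *
  filter_upwards [h, h'] with t ht ht' using ht.add ht'

theorem SmoothNear.sub (h : SmoothNear u x) (h' : SmoothNear v x) :
    SmoothNear (fun t => u t - v t) x := by
  unfold SmoothNear at *
  filter_upwards [h, h'] with t ht ht' using ht.sub ht'

theorem SmoothNear.pow (h : SmoothNear u x) (n : ℕ) : SmoothNear (fun t => u t ^ n) x := by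
  unfold SmoothNear at *
  filter_upwards [h] with t ht using ht.pow n

theorem SmoothNear.exp (h : SmoothNear u x) : SmoothNear (fun t => Real.exp (u t)) x := by
  unfold SmoothNear at *
  filter_upwards [h] with t ht using ht.exp

theorem SmoothNear.eventually_ne (h : SmoothNear u x) (h0 : u x ≠ 0) : ∀ᶠ t in 𝓝 x, u t ≠ 0 :=
  h.self.continuousAt.eventually_ne h0

theorem SmoothNear.div (h : SmoothNear u x) (h' : SmoothNear v x) (h0 : v x ≠ 0) :
    SmoothNear (fun t => u t / v t) x := by
  have h1 := h'.eventually_ne h0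
  unfold SmoothNear at *
  filter_upwards [h, h', h1] with t ht ht' h0 using ht.div ht' h0

theorem SmoothNear.comp {w : ℝ → E} (h : SmoothNear w (v x)) (h' : SmoothNear v x) :
    SmoothNear (fun t => w (v t)) x := by
  have h1 := h'.self.continuousAt.eventually h
  unfold SmoothNear at *
  filter_upwards [h1, h'] with t ht ht' using ht.comp t ht'

theorem smoothNear_pi {n : ℕ} {s : ℝ → Fin n → ℝ} :
    SmoothNear s x ↔ ∀ i, SmoothNear (fun t => s t i) x := by
  unfold SmoothNear
  simp only [contDiffAt_pi, Filter.eventually_all]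

/-- Smooth germs have smooth primitives. -/
theorem SmoothNear.exists_primitive (h : SmoothNear u x) (c : ℝ) :
    ∃ p : ℝ → ℝ, SmoothNear p x ∧ p x = c ∧ ∀ᶠ t in 𝓝 x, HasDerivAt p (u t) t := by
  obtain ⟨r, hr, hb⟩ := Metric.eventually_nhds_iff_ball.1 h
  have hc : ContinuousOn u (Metric.ball x r) := fun t ht =>
    (hb t ht).continuousAt.continuousWithinAt
  have hd : ∀ t ∈ Metric.ball x r, HasDerivAt (fun t => c + ∫ τ in x..t, u τ) (u t) t := by
    intro t ht
    refine HasDerivAt.const_add c ?_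
    refine intervalIntegral.integral_hasDerivAt_right ?_
      (hc.stronglyMeasurableAtFilter Metric.isOpen_ball t ht) (hb t ht).continuousAt
    refine (hc.mono ?_).intervalIntegrable
    exact ((convex_ball x r).ordConnected).uIcc_subset (Metric.mem_ball_self hr) ht
  have hm := Metric.ball_mem_nhds x hr
  refine ⟨fun t => c + ∫ τ in x..t, u τ, ?_, by simp, ?_⟩
  · have : ContDiffOn ℝ ∞ (fun t => c + ∫ τ in x..t, u τ) (Metric.ball x r) := by
      rw [contDiffOn_infty_iff_deriv_of_isOpen Metric.isOpen_ball]
      refine ⟨fun t ht => (hd t ht).differentiableAt.differentiableWithinAt, ?_⟩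
      exact ContDiffOn.congr (fun t ht => (hb t ht).contDiffWithinAt) fun t ht => (hd t ht).deriv
    unfold SmoothNear
    filter_upwards [hm] with t ht
    exact this.contDiffAt (Metric.isOpen_ball.mem_nhds ht)
  · filter_upwards [hm] with t ht using hd t ht

/-- Every finite jet of a scalar function is the jet of a smooth germ. -/
theorem exists_smoothNear_jet (x : ℝ) (k : ℕ) (w : Fin (k + 1) → ℝ) :
    ∃ p : ℝ → ℝ, SmoothNear p x ∧ ∀ j : Fin (k + 1), iteratedDeriv (j : ℕ) p x = w j := by
  induction k with
  | zero =>
    refine ⟨fun _ => w 0, smoothNear_const _, fun j => ?_⟩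
    obtain rfl : j = 0 := Fin.fin_one_eq_zero j
    simp
  | succ k ih =>
    obtain ⟨q, hq, hj⟩ := ih (fun j => w j.succ)
    obtain ⟨p, hp, h0, hd⟩ := hq.exists_primitive (w 0)
    refine ⟨p, hp, fun j => ?_⟩
    refine Fin.cases ?_ (fun j => ?_) j
    · simpa using h0
    · have : _root_.deriv p =ᶠ[𝓝 x] q := by filter_upwards [hd] with t ht using ht.deriv
      rw [Fin.val_succ, iteratedDeriv_succ', this.iteratedDeriv_eq, hj]

/-- Local inverses of smooth germs with nonzero derivative. -/
theorem SmoothNear.exists_inverse (h : SmoothNear u x) (h0 : _root_.deriv u x ≠ 0) :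
    ∃ w : ℝ → ℝ, SmoothNear w (u x) ∧ w (u x) = x ∧ (∀ᶠ t in 𝓝 x, w (u t) = t) ∧
      ∀ᶠ t in 𝓝 (u x), u (w t) = t := by
  have hs : HasStrictDerivAt u (_root_.deriv u x) x :=
    h.self.hasStrictDerivAt (by simp)
  have hs' := hs.hasStrictFDerivAt_equiv h0
  let e := hs'.toOpenPartialHomeomorph u
  have hx : u x ∈ e.target := hs'.image_mem_toOpenPartialHomeomorph_target
  have hi : e.symm (u x) = x := hs'.localInverse_apply_image
  refine ⟨e.symm, ?_, hi, hs'.eventually_left_inverse, hs'.eventually_right_inverse⟩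
  have hc : Filter.Tendsto e.symm (𝓝 (u x)) (𝓝 x) := by
    simpa [hi] using (e.continuousAt_symm hx).tendsto
  have h1 := hc.eventually h
  have h2 := hc.eventually (h.deriv.eventually_ne h0)
  unfold SmoothNear
  filter_upwards [h1, h2, e.open_target.mem_nhds hx] with t ht ht0 htt
  exact e.contDiffAt_symm_deriv ht0 htt (ht.differentiableAt (by simp)).hasDerivAt ht

/-- A smooth multiple of the pullback of a function that vanishes to order `k` vanishes to
order `k`. -/
theorem iteratedDeriv_mul_comp_eq_zero {m f δ : ℝ → ℝ} {x : ℝ} (k : ℕ) (hm : SmoothNear m x)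
    (hf : SmoothNear f x) (hδ : SmoothNear δ (f x))
    (h : ∀ j ≤ k, _root_.iteratedDeriv j δ (f x) = 0) :
    ∀ j ≤ k, _root_.iteratedDeriv j (fun t => m t * δ (f t)) x = 0 := by
  intro j hj
  induction j generalizing k m δ with
  | zero =>
    have := h 0 hj
    simp only [iteratedDeriv_zero] at this ⊢
    rw [this, mul_zero]
  | succ j ih =>
    -- The derivative is a sum of two products of the same kind, with multipliers m' and m f'; the
    -- second contains δ', which vanishes to order k - 1. Hence the induction is over all m, δ and
    -- k.
    have e : _root_.deriv (fun t => m t * δ (f t)) =ᶠ[𝓝 x]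
        fun t => _root_.deriv m t * δ (f t) +
          (m t * _root_.deriv f t) * _root_.deriv δ (f t) := by
      have h1 := hf.self.continuousAt.eventually hδ.eventually
      filter_upwards [hm.eventually, hf.eventually, h1] with t h1 h2 h3
      have := h1.hasDerivAt.mul (h3.hasDerivAt.comp t h2.hasDerivAt)
      refine (HasDerivAt.deriv this).trans ?_
      simp only [Function.comp]; ring
    have s1 : SmoothNear (fun t => _root_.deriv m t * δ (f t)) x := hm.deriv.mul (hδ.comp hf)
    have s2 : SmoothNear (fun t => (m t * _root_.deriv f t) * _root_.deriv δ (f t)) x :=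
      (hm.mul hf.deriv).mul (hδ.deriv.comp hf)
    have hle : ((j : ℕ∞) : ℕ∞ω) ≤ ∞ := by exact_mod_cast le_top
    rw [iteratedDeriv_succ', e.iteratedDeriv_eq,
      iteratedDeriv_fun_add (s1.self.of_le hle) (s2.self.of_le hle),
      ih k hm.deriv hδ h (by omega), ih (k - 1) (hm.mul hf.deriv) hδ.deriv _ (by omega), add_zero]
    intro i hi
    rw [← iteratedDeriv_succ']
    exact h _ (by omega)

end SmoothNear

end Abel

namespace Abel

/-! ### Jets, total derivative, smoothness at regular points -/

section Jets

variable {k l m n : ℕ}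

theorem contDiff_proj (h : l ≤ k) : ContDiff ℝ ∞ (proj h : Jet k → Jet l) := by
  unfold proj; fun_prop

theorem hasDerivAt_jet {s : ℝ → Fin 4 → ℝ} {x : ℝ} (h : SmoothNear s x) (k : ℕ) :
    HasDerivAt (jet k s) ((1 : ℝ), fun i (j : Fin (k + 1)) => (jet (k + 1) s x).2 i j.succ) x := by
  refine (hasDerivAt_id x).prodMk ?_
  rw [hasDerivAt_pi]
  intro i
  rw [hasDerivAt_pi]
  intro j
  have := ((smoothNear_pi.1 h i).iteratedDeriv j).hasDerivAt
  simpa [jet, iteratedDeriv_succ] using this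

theorem hasDerivAt_comp_jet {s : ℝ → Fin 4 → ℝ} {x : ℝ} (h : SmoothNear s x) {I : Jet k → ℝ}
    (hI : DifferentiableAt ℝ I (jet k s x)) :
    HasDerivAt (fun t => I (jet k s t)) (totalD I (jet (k + 1) s x)) x :=
  HasFDerivAt.comp_hasDerivAt x hI.hasFDerivAt (hasDerivAt_jet h k)

/-- Every point of the jet space is the jet of a smooth germ of a section. -/
theorem exists_jet_eq (z : Jet k) : ∃ s, SmoothNear s z.1 ∧ jet k s z.1 = z := by
  choose p hp hj using fun i => exists_smoothNear_jet z.1 k (z.2 i)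
  refine ⟨fun t i => p i t, smoothNear_pi.2 hp, ?_⟩
  refine Prod.ext rfl ?_
  funext i j
  exact hj i j

theorem contDiff_s1 : ContDiff ℝ ∞ (s1 : Jet (n + 1) → ℝ) := by
  unfold s1; fun_prop

theorem contDiff_s3 : ContDiff ℝ ∞ (s3 : Jet (n + 1) → ℝ) := by
  unfold s3; fun_prop

theorem isOpen_reg (n : ℕ) : IsOpen (Reg n) :=
  isOpen_ne_fun (contDiff_s1.continuous.mul contDiff_s3.continuous) continuous_const

theorem s1_proj (h : m + 1 ≤ n + 1) (z : Jet (n + 1)) : s1 (proj h z) = s1 z := rfl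

theorem s3_proj (h : m + 1 ≤ n + 1) (z : Jet (n + 1)) : s3 (proj h z) = s3 z := rfl

theorem coeff_proj (h : m + 1 ≤ n + 1) (z : Jet (n + 1)) : coeff (proj h z) = coeff z := rfl

theorem s1_ne_zero {z : Jet (n + 1)} (h : z ∈ Reg n) : s1 z ≠ 0 := left_ne_zero_of_mul h

theorem s3_ne_zero {z : Jet (n + 1)} (h : z ∈ Reg n) : s3 z ≠ 0 := right_ne_zero_of_mul h

theorem contDiffOn_totalD {I : Jet k → ℝ} {U : Set (Jet k)} (hU : IsOpen U)
    (hI : ContDiffOn ℝ ∞ I U) :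
    ContDiffOn ℝ ∞ (totalD I) (proj (Nat.le_succ k) ⁻¹' U) := by
  have h1 : ContDiffOn ℝ ∞ (fderiv ℝ I) U := hI.fderiv_of_isOpen hU (by simp)
  have h2 := h1.comp (contDiff_proj (Nat.le_succ k)).contDiffOn (Set.mapsTo_preimage _ _)
  refine h2.clm_apply (ContDiff.contDiffOn ?_)
  fun_prop

theorem coeff_ne_zero {z : Jet (n + 1)} (h : z ∈ Reg n) : coeff z ≠ 0 :=
  div_ne_zero (s1_ne_zero h)
    (Real.rpow_pos_of_pos (abs_pos.2 (s3_ne_zero h)) _).ne'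

theorem contDiffOn_coeff : ContDiffOn ℝ ∞ (coeff : Jet (n + 1) → ℝ) (Reg n) := by
  intro z hz
  refine ContDiffAt.contDiffWithinAt ?_
  have h3 := s3_ne_zero hz
  have habs : ContDiffAt ℝ ∞ (fun z : Jet (n + 1) => |s3 z|) z :=
    (contDiffAt_abs h3).comp z contDiff_s3.contDiffAt
  exact contDiff_s1.contDiffAt.div (habs.rpow_const_of_ne (abs_pos.2 h3).ne')
    (Real.rpow_pos_of_pos (abs_pos.2 h3) _).ne'

theorem contDiffOn_nabla {I : Jet (n + 1) → ℝ} (hI : ContDiffOn ℝ ∞ I (Reg n)) :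
    ContDiffOn ℝ ∞ (nabla I) (Reg (n + 1)) :=
  contDiffOn_coeff.mul (contDiffOn_totalD (isOpen_reg n) hI)

theorem contDiffOn_nablaIter {I : Jet (m + 1) → ℝ} (hI : ContDiffOn ℝ ∞ I (Reg m)) (i : ℕ) :
    ContDiffOn ℝ ∞ (nablaIter I i) (Reg (m + i)) := by
  induction i with
  | zero => exact hI
  | succ i ih => exact contDiffOn_nabla ih

theorem differentiableAt_of_reg {I : Jet (n + 1) → ℝ} (hI : ContDiffOn ℝ ∞ I (Reg n))
    {z : Jet (n + 1)} (hz : z ∈ Reg n) : DifferentiableAt ℝ I z :=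
  (hI.contDiffAt ((isOpen_reg n).mem_nhds hz)).differentiableAt (by simp)

theorem contDiff_s5 : ContDiff ℝ ∞ s5 := by
  have h := contDiffOn_totalD isOpen_univ (contDiff_s3 (n := 0)).contDiffOn
  rw [Set.preimage_univ, contDiffOn_univ] at h
  have h3 := contDiff_s3 (n := 1)
  unfold s5
  fun_prop

theorem contDiffOn_J1 : ContDiffOn ℝ ∞ J1 (Reg 1) :=
  (contDiff_s5.pow 3).contDiffOn.div (contDiff_s3.pow 5).contDiffOn
    fun _ hz => pow_ne_zero 5 (s3_ne_zero hz)

end Jets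

/-! ### The real cube root and J₁^{1/3} -/

section CubeRoot

theorem cbrt_pow_three (x : ℝ) : cbrt x ^ 3 = x := by
  have h : (|x| ^ (1 / 3 : ℝ)) ^ 3 = |x| := by
    rw [← Real.rpow_natCast, ← Real.rpow_mul (abs_nonneg x)]; norm_num
  rw [cbrt, mul_pow, h]
  rcases lt_trichotomy x 0 with hx | rfl | hx
  · rw [Real.sign_of_neg hx, abs_of_neg hx]; ring
  · simp
  · rw [Real.sign_of_pos hx, abs_of_pos hx]; ring

theorem cbrt_pow (x : ℝ) : cbrt (x ^ 3) = x :=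
  (Odd.strictMono_pow (by decide : Odd 3)).injective (cbrt_pow_three (x ^ 3))

theorem cbrt_ne_zero {x : ℝ} (h : x ≠ 0) : cbrt x ≠ 0 := fun h' => h (by
  rw [← cbrt_pow_three x, h']; norm_num)

theorem contDiffAt_cbrt {x : ℝ} (h : x ≠ 0) : ContDiffAt ℝ ∞ cbrt x := by
  have habs : ContDiffAt ℝ ∞ (fun x : ℝ => |x| ^ (1 / 3 : ℝ)) x :=
    (contDiffAt_abs h).rpow_const_of_ne (abs_pos.2 h).ne'
  have hs : Real.sign =ᶠ[𝓝 x] fun _ => Real.sign x := by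
    rcases h.lt_or_gt with h | h
    · filter_upwards [eventually_lt_nhds h] with t ht
      rw [Real.sign_of_neg ht, Real.sign_of_neg h]
    · filter_upwards [eventually_gt_nhds h] with t ht
      rw [Real.sign_of_pos ht, Real.sign_of_pos h]
  refine (contDiffAt_const.mul habs).congr_of_eventuallyEq
    (f := fun t => Real.sign x * |t| ^ (1 / 3 : ℝ)) ?_
  filter_upwards [hs] with t ht
  rw [cbrt, ht]

theorem continuous_cbrt : Continuous cbrt := by
  have hm : StrictMono cbrt := fun x y h => by
    by_contra! h'
    have := (Odd.strictMono_pow (by decide : Odd 3)).monotone h'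
    simp only [cbrt_pow_three] at this
    exact absurd h this.not_gt
  exact hm.monotone.continuous_of_surjective fun x => ⟨x ^ 3, cbrt_pow x⟩

/-- In this form only the cube root of `s3` is taken, which is smooth at regular points even where
J₁ = 0. -/
theorem J1root_eq (z : Jet (1 + 1)) : J1root z = s5 z / cbrt (s3 z) ^ 5 := by
  have h : J1 z = (s5 z / cbrt (s3 z) ^ 5) ^ 3 := by
    rw [J1, div_pow, ← pow_mul, mul_comm 5 3, pow_mul, cbrt_pow_three]
  rw [J1root, h, cbrt_pow]

theorem contDiffOn_J1root : ContDiffOn ℝ ∞ J1root (Reg 1) := by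
  have h : ContDiffOn ℝ ∞ (fun z : Jet (1 + 1) => s5 z / cbrt (s3 z) ^ 5) (Reg 1) := by
    refine contDiff_s5.contDiffOn.div ?_ fun z hz => pow_ne_zero 5 (cbrt_ne_zero (s3_ne_zero hz))
    intro z hz
    exact (((contDiffAt_cbrt (s3_ne_zero hz)).comp z contDiff_s3.contDiffAt).pow 5).contDiffWithinAt
  exact h.congr fun z _ => J1root_eq z

end CubeRoot

end Abel

/-! ### Relative invariance of s₁, s₃, s₅ -/

namespace Abel

namespace Transforms

variable {f g h : ℝ → ℝ} {s s' : ℝ → Fin 4 → ℝ} {x : ℝ}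

theorem eventually (T : Transforms f g h s s' x) : ∀ᶠ t in 𝓝 x, Transforms f g h s s' t := by
  filter_upwards [T.smooth_f.eventually, T.smooth_g.eventually, T.smooth_h.eventually,
    T.smooth_source.eventually, T.smooth_f.self.continuousAt.eventually T.smooth_target.eventually,
    T.smooth_f.deriv.eventually_ne T.deriv_ne, T.smooth_g.eventually_ne T.scale_ne,
    eventually_eventually_nhds.2 T.equation] with t h1 h2 h3 h4 h5 h6 h7 h8
  exact ⟨h1, h2, h3, h4, h5, h6, h7, h8⟩

/-- The coefficientwise form of the transformation law at one point. -/
theorem coeffs (T : Transforms f g h s s' x) :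
    s x 0 = deriv f x * g x ^ 2 * s' (f x) 0 ∧
    s x 1 = deriv f x * (3 * s' (f x) 0 * g x * h x + s' (f x) 1 * g x) ∧
    deriv g x + g x * s x 2 = deriv f x *
      (3 * s' (f x) 0 * g x * h x ^ 2 + 2 * s' (f x) 1 * g x * h x + s' (f x) 2 * g x) ∧
    g x * s x 3 + deriv h x = deriv f x *
      (s' (f x) 0 * h x ^ 3 + s' (f x) 1 * h x ^ 2 + s' (f x) 2 * h x + s' (f x) 3) := by
  have hg := T.scale_ne
  have e := T.equation.self_of_nhds
  simp only [abel] at e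
  -- Both sides are cubic in y, so the values at 0, 1, -1, 2 determine all coefficients.
  have e0 := e 0
  have e1 := e 1
  have e2 := e (-1)
  have e3 := e 2
  refine ⟨mul_left_cancel₀ hg ?_, mul_left_cancel₀ hg ?_, ?_, ?_⟩ <;> linarith

/-- A direct computation: the transformed coefficients are differentiated and substituted, and the
terms in f'', g' and h' cancel. -/
theorem s3_eq (T : Transforms f g h s s' x) (n : ℕ) :
    s3 (jet (n + 1) s x) = (deriv f x * g x) ^ 3 * s3 (jet (n + 1) s' (f x)) := by
  obtain ⟨e0, e1, e2, e3⟩ := T.coeffs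
  have df := T.smooth_f.hasDerivAt
  have df' := T.smooth_f.deriv.hasDerivAt
  have dg := T.smooth_g.hasDerivAt
  have dh := T.smooth_h.hasDerivAt
  have d0 := ((smoothNear_pi.1 T.smooth_target 0).hasDerivAt).comp x df
  have d1 := ((smoothNear_pi.1 T.smooth_target 1).hasDerivAt).comp x df
  have D0 := ((df'.mul (dg.pow 2)).mul d0).congr_of_eventuallyEq
    (f₁ := fun t => s t 0) (by filter_upwards [T.eventually] with t ht using ht.coeffs.1)
  have D1 := (df'.mul ((((d0.const_mul 3).mul dg).mul dh).add (d1.mul dg))).congr_of_eventuallyEq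
    (f₁ := fun t => s t 1) (by filter_upwards [T.eventually] with t ht using ht.coeffs.2.1)
  have D0 := D0.deriv
  have D1 := D1.deriv
  simp only [Function.comp, Pi.mul_apply, Pi.pow_apply, Pi.add_apply] at D0 D1
  have hg := T.scale_ne
  -- Writing g' and h' as multiples of g turns the claim into a polynomial identity.
  obtain ⟨G, hG⟩ : ∃ G, deriv g x = g x * G := ⟨deriv g x / g x, by field_simp⟩
  obtain ⟨H, hH⟩ : ∃ H, deriv h x = g x * H := ⟨deriv h x / g x, by field_simp⟩
  have e2' : s x 2 = deriv f x *
      (3 * s' (f x) 0 * h x ^ 2 + 2 * s' (f x) 1 * h x + s' (f x) 2) - G :=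
    mul_left_cancel₀ hg (by rw [hG] at e2; linear_combination e2)
  have e3' : g x * s x 3 = deriv f x *
      (s' (f x) 0 * h x ^ 3 + s' (f x) 1 * h x ^ 2 + s' (f x) 2 * h x + s' (f x) 3) - g x * H := by
    linear_combination e3 - hH
  -- d is known only through g d; one of the four factors g in a² supplies the missing g.
  have e3'' : s x 0 ^ 2 * s x 3 = (deriv f x * s' (f x) 0) ^ 2 * g x ^ 3 * (g x * s x 3) := by
    rw [e0]; ring
  rw [e3'] at e3''
  rw [hG] at D0 D1
  rw [hH] at D1
  simp only [s3, jet, Fin.val_zero, Fin.val_one, iteratedDeriv_zero, iteratedDeriv_one]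
  rw [D0, D1, mul_assoc 3 (s x 0 ^ 2), e3'', e0, e1, e2']
  ring

theorem mem_reg_iff (T : Transforms f g h s s' x) (n : ℕ) :
    jet (n + 1) s x ∈ Reg n ↔ jet (n + 1) s' (f x) ∈ Reg n := by
  have e := T.s3_eq n
  have e1 : s1 (jet (n + 1) s x) = deriv f x * g x ^ 2 * s1 (jet (n + 1) s' (f x)) := by
    simpa [s1, jet] using T.coeffs.1
  simp only [Reg, Set.mem_ofPred_eq, e, e1]
  have := T.deriv_ne
  have := T.scale_ne
  simp [*]

/-- The factor f'g² of `s1` over the factor (f'g)² of s₃^{2/3} leaves 1/f'. -/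
theorem coeff_eq (T : Transforms f g h s s' x) (n : ℕ) :
    coeff (jet (n + 1) s' (f x)) = coeff (jet (n + 1) s x) * deriv f x := by
  have e := T.s3_eq n
  have e1 : s1 (jet (n + 1) s x) = deriv f x * g x ^ 2 * s1 (jet (n + 1) s' (f x)) := by
    simpa [s1, jet] using T.coeffs.1
  have hf := T.deriv_ne
  have hg := T.scale_ne
  have h1 : |(deriv f x * g x) ^ 3| ^ (2 / 3 : ℝ) = (deriv f x * g x) ^ 2 := by
    rw [abs_pow, ← Real.rpow_natCast, ← Real.rpow_mul (abs_nonneg _), ← sq_abs (deriv f x * g x),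
      ← Real.rpow_natCast]
    norm_num
  simp only [coeff]
  rw [e, e1, abs_mul, Real.mul_rpow (abs_nonneg _) (abs_nonneg _), h1]
  -- Regularity is not assumed: for s₃ = 0 both quotients are 0 by convention.
  by_cases h3 : |s3 (jet (n + 1) s' (f x))| ^ (2 / 3 : ℝ) = 0
  · simp [h3]
  · field_simp

/-- Differentiating the law for `s3` produces the extra term 3 s₃ (log f'g)'. The expression a' + a
c - b²/3 has weight f'²g² up to the extra term a (log f'g)', so the combination in `s5` cancels
both. -/
theorem s5_eq (T : Transforms f g h s s' x) :
    s5 (jet 2 s x) = (deriv f x * g x) ^ 5 * s5 (jet 2 s' (f x)) := by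
  obtain ⟨e0, e1, e2, e3⟩ := T.coeffs
  have df := T.smooth_f.hasDerivAt
  have df' := T.smooth_f.deriv.hasDerivAt
  have dg := T.smooth_g.hasDerivAt
  have d0 := ((smoothNear_pi.1 T.smooth_target 0).hasDerivAt).comp x df
  have D0 := ((df'.mul (dg.pow 2)).mul d0).congr_of_eventuallyEq
    (f₁ := fun t => s t 0) (by filter_upwards [T.eventually] with t ht using ht.coeffs.1)
  have D0 := D0.deriv
  have hd : ∀ w : Jet 1, DifferentiableAt ℝ s3 w := fun w =>
    (contDiff_s3 (n := 0)).contDiffAt.differentiableAt (by simp)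
  have h3 := hasDerivAt_comp_jet T.smooth_source (hd (jet 1 s x))
  have h3' := (hasDerivAt_comp_jet T.smooth_target (hd (jet 1 s' (f x)))).comp x df
  have D3 := ((((df'.mul dg).pow 3).mul h3').congr_of_eventuallyEq
    (f₁ := fun t => s3 (jet 1 s t))
    (by filter_upwards [T.eventually] with t ht using ht.s3_eq 0)).unique h3
  simp only [Function.comp, Pi.mul_apply, Pi.pow_apply] at D0 D3
  have hg := T.scale_ne
  obtain ⟨G, hG⟩ : ∃ G, deriv g x = g x * G := ⟨deriv g x / g x, by field_simp⟩
  have e2' : s x 2 = deriv f x *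
      (3 * s' (f x) 0 * h x ^ 2 + 2 * s' (f x) 1 * h x + s' (f x) 2) - G :=
    mul_left_cancel₀ hg (by rw [hG] at e2; linear_combination e2)
  rw [hG] at D0 D3
  simp only [s5]
  have E3 := T.s3_eq 1
  have E3' : s3 (jet (0 + 1) s' (f x)) = s3 (jet (1 + 1) s' (f x)) := rfl
  rw [E3'] at D3
  rw [E3, ← D3]
  generalize s3 (jet (1 + 1) s' (f x)) = S
  generalize totalD s3 (jet (1 + 1) s' (f x)) = DS
  simp only [jet, Fin.val_zero, Fin.val_one, iteratedDeriv_zero, iteratedDeriv_one]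
  rw [D0, e0, e1, e2']
  ring

end Transforms

/-! ### Invariance of ∇ and of the generated functions -/

theorem isInvariantDerivation_coeff : IsInvariantDerivation coeff := by
  intro f g h s s' x T n I hI hz
  have hI' := differentiableAt_of_reg hI ((T.mem_reg_iff n).1 hz)
  have := (hasDerivAt_comp_jet T.smooth_target hI').comp x T.smooth_f.hasDerivAt
  have e : deriv (fun t => I (jet (n + 1) s' (f t))) x = _ := this.deriv
  rw [e]
  change coeff (jet (n + 1 + 1) s' (f x)) * _ = coeff (jet (n + 1 + 1) s x) * _
  rw [T.coeff_eq]
  ring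

theorem SameOrbit.proj {k l : ℕ} (h : l ≤ k) {z z' : Jet k} (H : SameOrbit z z') :
    SameOrbit (proj h z) (proj h z') := by
  obtain ⟨f, g, u, s, s', T, hf, hs, hs'⟩ := H
  refine ⟨f, g, u, s, s', T, hf, ?_, ?_⟩
  · conv_rhs => rw [← hs]
    rfl
  · conv_rhs => rw [← hs']
    rfl

theorem invariants_eq_of_transforms {n : ℕ} {I : Jet (n + 1) → ℝ} (hI : I ∈ invariants (Reg n))
    {f g h : ℝ → ℝ} {s s' : ℝ → Fin 4 → ℝ} {x : ℝ} (T : Transforms f g h s s' x)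
    (hz : jet (n + 1) s x ∈ Reg n) : I (jet (n + 1) s x) = I (jet (n + 1) s' (f x)) :=
  hI.2 _ hz _ ((T.mem_reg_iff n).1 hz) ⟨f, g, h, s, s', T, rfl, rfl, rfl⟩

theorem nabla_jet {n : ℕ} {I : Jet (n + 1) → ℝ} (hI : ContDiffOn ℝ ∞ I (Reg n))
    {s : ℝ → Fin 4 → ℝ} {x : ℝ} (hs : SmoothNear s x) (hz : jet (n + 1) s x ∈ Reg n) :
    nabla I (jet (n + 1 + 1) s x) =
      coeff (jet (n + 1) s x) * deriv (fun t => I (jet (n + 1) s t)) x := by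
  rw [(hasDerivAt_comp_jet hs (differentiableAt_of_reg hI hz)).deriv]
  rfl

theorem nabla_mem_invariants {n : ℕ} {I : Jet (n + 1) → ℝ} (hI : I ∈ invariants (Reg n)) :
    nabla I ∈ invariants (Reg (n + 1)) := by
  refine ⟨contDiffOn_nabla hI.1, ?_⟩
  rintro z hz z' hz' ⟨f, g, h, s, s', T, hf, hs, hs'⟩
  have hz1 : jet (n + 1) s z.1 ∈ Reg n := by
    rw [← hs] at hz; exact hz
  rw [← hs, ← hs', ← hf]
  have e := isInvariantDerivation_coeff f g h s s' z.1 T n I hI.1 hz1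
  -- The same transformation relates the jets at all nearby points, so the invariance of I holds
  -- along the germ and can be differentiated.
  have e' : (fun t => I (jet (n + 1) s' (f t))) =ᶠ[𝓝 z.1] fun t => I (jet (n + 1) s t) := by
    have hc := (hasDerivAt_jet T.smooth_source (n + 1)).continuousAt.eventually
      ((isOpen_reg n).mem_nhds hz1)
    filter_upwards [T.eventually, hc] with t ht hzt
    exact (invariants_eq_of_transforms hI ht hzt).symm
  rw [e'.deriv_eq] at e
  have e2 := nabla_jet hI.1 T.smooth_source hz1
  simp only [jet] at e2 e ⊢
  exact e2.trans e.symm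

theorem lift_mem_invariants {m n : ℕ} (h : m + 1 ≤ n + 1) {I : Jet (m + 1) → ℝ}
    (hI : I ∈ invariants (Reg m)) : (fun z => I (proj h z)) ∈ invariants (Reg n) :=
  ⟨hI.1.comp (contDiff_proj h).contDiffOn fun _ hz => hz,
    fun _ hz _ hz' H => hI.2 _ hz _ hz' (H.proj h)⟩

theorem J1_mem_invariants : J1 ∈ invariants (Reg 1) := by
  refine ⟨contDiffOn_J1, ?_⟩
  rintro z hz z' hz' ⟨f, g, h, s, s', T, hf, hs, hs'⟩
  rw [← hs, ← hs', ← hf]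
  have hz3 := s3_ne_zero hz'
  rw [← hs', ← hf] at hz3
  have e := T.s3_eq 1
  have e5 := T.s5_eq
  have hfg := mul_ne_zero T.deriv_ne T.scale_ne
  change s5 (jet 2 s z.1) ^ 3 / s3 (jet (1 + 1) s z.1) ^ 5 =
    s5 (jet 2 s' (f z.1)) ^ 3 / s3 (jet (1 + 1) s' (f z.1)) ^ 5
  rw [e, e5]
  generalize deriv f z.1 * g z.1 = r at hfg
  field_simp

theorem J1root_mem_invariants : J1root ∈ invariants (Reg 1) :=
  ⟨contDiffOn_J1root, fun z hz z' hz' H => by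
    rw [J1root, J1root, J1_mem_invariants.2 z hz z' hz' H]⟩

theorem nablaIter_mem_invariants {m : ℕ} {I : Jet (m + 1) → ℝ} (hI : I ∈ invariants (Reg m))
    (i : ℕ) : nablaIter I i ∈ invariants (Reg (m + i)) := by
  induction i with
  | zero => exact hI
  | succ i ih => exact nabla_mem_invariants ih

theorem Generated.mem_invariants {n : ℕ} {I : Jet (n + 1) → ℝ} (h : Generated n I) :
    I ∈ invariants (Reg n) := by
  induction h with
  | base => exact J1_mem_invariants
  | nabla _ ih => exact nabla_mem_invariants ih
  | lift h _ ih => exact lift_mem_invariants _ ih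
  | comp I F K _ _ hK e ih =>
    refine ⟨hK, fun z hz z' hz' H => ?_⟩
    rw [e z hz, e z' hz']
    congr 1
    funext i
    exact (ih i).2 z hz z' hz' H

/-- The cube root is not smooth at 0; `Generated.comp` asks only for a continuous outer function. -/
theorem generated_J1root : Generated 1 J1root :=
  Generated.comp (p := 1) (fun _ => J1) (fun t => cbrt (t 0)) J1root (fun _ => Generated.base)
    (continuous_cbrt.comp (continuous_apply 0)) contDiffOn_J1root fun _ _ => rfl

theorem Generated.nablaIter {m : ℕ} {I : Jet (m + 1) → ℝ} (h : Generated m I) (i : ℕ) :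
    Generated (m + i) (nablaIter I i) := by
  induction i with
  | zero => exact h
  | succ i ih => exact ih.nabla

end Abel

/-! ### Dependence of the tower on the highest derivatives of d and b -/

namespace Abel

/-- The tangent vector to `J^k(π)` along the coordinate `u_v^{(j)}`; it is zero if `j > k`. -/
def unitVec (k : ℕ) (v : Fin 4) (j : ℕ) : Jet k :=
  (0, fun i l => if i = v ∧ (l : ℕ) = j then 1 else 0)

section UnitVec

variable {k l m n : ℕ}

theorem unitVec_eq_zero {v : Fin 4} {j : ℕ} (h : k < j) : unitVec k v j = 0 := by
  refine Prod.ext rfl ?_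
  funext i l
  have : (l : ℕ) ≠ j := by have := l.2; omega
  simp [unitVec, this]

theorem proj_add_smul_unitVec (h : l ≤ k) (z : Jet k) (p : ℝ) (v : Fin 4) (j : ℕ) :
    proj h (z + p • unitVec k v j) = proj h z + p • unitVec l v j := rfl

theorem add_smul_unitVec_apply (z : Jet k) (p : ℝ) (v i : Fin 4) (j : ℕ) (l : Fin (k + 1)) :
    (z + p • unitVec k v j).2 i l = z.2 i l + if i = v ∧ (l : ℕ) = j then p else 0 := by
  simp [unitVec]

theorem s1_add {v : Fin 4} {j : ℕ} (hj : j ≠ 0) (z : Jet (n + 1)) (p : ℝ) :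
    s1 (z + p • unitVec (n + 1) v j) = s1 z := by
  simp [s1, add_smul_unitVec_apply, hj.symm]

theorem s3_add {v : Fin 4} {j : ℕ} (hj : 2 ≤ j) (z : Jet (n + 1)) (p : ℝ) :
    s3 (z + p • unitVec (n + 1) v j) = s3 z := by
  have h0 : 0 ≠ j := by omega
  have h1 : 1 ≠ j := by omega
  simp [s3, add_smul_unitVec_apply, h0, h1]

theorem s3_add_three {j : ℕ} (hj : j ≠ 0) (z : Jet (n + 1)) (p : ℝ) :
    s3 (z + p • unitVec (n + 1) 3 j) = s3 z := by
  simp [s3, add_smul_unitVec_apply, hj.symm]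

theorem s3_add_three_zero (z : Jet (n + 1)) (p : ℝ) :
    s3 (z + p • unitVec (n + 1) 3 0) = s3 z + p * (-3 * s1 z ^ 2) := by
  simp [s3, s1, add_smul_unitVec_apply]
  ring

theorem s3_add_one_one (z : Jet (n + 1)) (p : ℝ) :
    s3 (z + p • unitVec (n + 1) 1 1) = s3 z + p * (-s1 z) := by
  simp [s3, s1, add_smul_unitVec_apply]
  ring

/-- If a function does not depend on `u_v^{(j+1)}` and is affine in `u_v^{(j)}`, its total
derivative is affine in `u_v^{(j+1)}`, with the same slope. -/
theorem totalD_add {I A : Jet k → ℝ} {U : Set (Jet k)} (hU : IsOpen U)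
    (hI : ∀ w ∈ U, DifferentiableAt ℝ I w) {v : Fin 4} {j : ℕ}
    (h1 : ∀ w ∈ U, ∀ p : ℝ, I (w + p • unitVec k v (j + 1)) = I w)
    (h0 : ∀ w ∈ U, ∀ p : ℝ, I (w + p • unitVec k v j) = I w + p * A w)
    (z : Jet (k + 1)) (hz : proj (Nat.le_succ k) z ∈ U) (p : ℝ) :
    totalD I (z + p • unitVec (k + 1) v (j + 1)) = totalD I z + p * A (proj (Nat.le_succ k) z) := by
  set w := proj (Nat.le_succ k) z with hw
  -- I does not see the shift near w, so its differential is unchanged. The total derivative then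
  -- varies only through its direction, which moves by `p • unitVec k v j`.
  have e1 : fderiv ℝ I (w + p • unitVec k v (j + 1)) = fderiv ℝ I w := by
    rw [← fderiv_comp_add_right]
    refine Filter.EventuallyEq.fderiv_eq ?_
    filter_upwards [hU.mem_nhds hz] with y hy using h1 y hy p
  have e2 : fderiv ℝ I w (unitVec k v j) = A w := by
    have hl : HasDerivAt (fun q : ℝ => w + q • unitVec k v j) (unitVec k v j) 0 := by
      simpa using ((hasDerivAt_id (0 : ℝ)).smul_const (unitVec k v j)).const_add w
    have hI' : HasFDerivAt I (fderiv ℝ I w) (w + (0 : ℝ) • unitVec k v j) := by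
      simpa using (hI w hz).hasFDerivAt
    have d1 := hI'.comp_hasDerivAt (0 : ℝ) hl
    have d2 : HasDerivAt (fun q : ℝ => I w + q * A w) (A w) 0 := by
      simpa using ((hasDerivAt_id (0 : ℝ)).mul_const (A w)).const_add (I w)
    refine (d1.congr_of_eventuallyEq (Filter.Eventually.of_forall fun q => ?_)).unique d2
    exact (h0 w hz q).symm
  have e3 : ((1 : ℝ), fun (i : Fin 4) (l : Fin (k + 1)) =>
      (z + p • unitVec (k + 1) v (j + 1)).2 i l.succ) =
      ((1 : ℝ), fun (i : Fin 4) (l : Fin (k + 1)) => z.2 i l.succ) + p • unitVec k v j := by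
    refine Prod.ext (by simp [unitVec]) ?_
    funext i l
    simp [unitVec]
  rw [totalD, proj_add_smul_unitVec, ← hw, e1, e3, map_add, map_smul, e2, smul_eq_mul]
  rfl

theorem totalD_s3_add {v : Fin 4} {j : ℕ} {A : Jet 1 → ℝ}
    (h1 : ∀ w : Jet 1, ∀ p : ℝ, s3 (w + p • unitVec 1 v (j + 1)) = s3 w)
    (h0 : ∀ w : Jet 1, ∀ p : ℝ, s3 (w + p • unitVec 1 v j) = s3 w + p * A w) (z : Jet 2) (p : ℝ) :
    totalD (k := 1) s3 (z + p • unitVec 2 v (j + 1)) =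
      totalD (k := 1) s3 z + p * A (proj (Nat.le_succ 1) z) :=
  totalD_add isOpen_univ
    (fun _ _ => (contDiff_s3 (n := 0)).contDiffAt.differentiableAt (by simp))
    (fun w _ p => h1 w p) (fun w _ p => h0 w p) z (Set.mem_univ _) p

/-- d' enters `s5` only through a Ds₃/Dx, where its slope is a times the slope -3a² of `s3` in d. -/
theorem s5_add_three_one (z : Jet 2) (p : ℝ) :
    s5 (z + p • unitVec 2 3 1) = s5 z + p * (-3 * s1 (n := 1) z ^ 3) := by
  have h := totalD_s3_add (v := 3) (j := 0) (A := fun w => -3 * s1 (n := 0) w ^ 2)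
    (fun w p => s3_add_three (n := 0) (by norm_num) w p) (s3_add_three_zero (n := 0)) z p
  have h3 := s3_add_three (n := 1) one_ne_zero z p
  rw [zero_add] at h
  rw [s5, s5, h, h3]
  simp [add_smul_unitVec_apply, s1, proj]
  ring

theorem s5_add_three_two (z : Jet 2) (p : ℝ) : s5 (z + p • unitVec 2 3 2) = s5 z := by
  have h := totalD_s3_add (v := 3) (j := 1) (A := fun w => 0)
    (fun w p => s3_add_three (n := 0) (by norm_num) w p)
    (fun w p => by rw [s3_add_three (n := 0) (by norm_num) w p]; simp) z p
  have h3 := s3_add_three (n := 1) two_ne_zero z p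
  rw [s5, s5, h, h3]
  simp [add_smul_unitVec_apply]

theorem s5_add_one_two (z : Jet 2) (p : ℝ) :
    s5 (z + p • unitVec 2 1 2) = s5 z + p * (-s1 (n := 1) z ^ 2) := by
  have h := totalD_s3_add (v := 1) (j := 1) (A := fun w => -s1 (n := 0) w)
    (fun w p => s3_add (n := 0) (by norm_num) w p) (s3_add_one_one (n := 0)) z p
  have h3 := s3_add (n := 1) (v := 1) le_rfl z p
  rw [s5, s5, h, h3]
  simp [add_smul_unitVec_apply, s1, proj]
  ring

theorem add_mem_reg {v : Fin 4} {j : ℕ} (hj : 2 ≤ j ∨ v = 3 ∧ j ≠ 0) {z : Jet (n + 1)}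
    (hz : z ∈ Reg n) (p : ℝ) : z + p • unitVec (n + 1) v j ∈ Reg n := by
  rcases hj with hj | ⟨rfl, hj⟩
  · simpa only [Reg, Set.mem_ofPred_eq, s1_add (by omega : j ≠ 0), s3_add hj] using hz
  · simpa only [Reg, Set.mem_ofPred_eq, s1_add hj, s3_add_three hj] using hz

/-- The inductive step along the tower: ∇ moves the leading coordinate up by one derivative and
multiplies its slope by `coeff`. As j ≥ 1, the shifted coordinate has order at least 2 and does not
affect `coeff`. -/
theorem nabla_add {I A : Jet (n + 1) → ℝ} (hI : ContDiffOn ℝ ∞ I (Reg n)) {v : Fin 4} {j : ℕ}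
    (hj : 1 ≤ j)
    (h1 : ∀ w ∈ Reg n, ∀ p : ℝ, I (w + p • unitVec (n + 1) v (j + 1)) = I w)
    (h0 : ∀ w ∈ Reg n, ∀ p : ℝ, I (w + p • unitVec (n + 1) v j) = I w + p * A w)
    {z : Jet (n + 1 + 1)} (hz : z ∈ Reg (n + 1)) (p : ℝ) :
    nabla I (z + p • unitVec (n + 1 + 1) v (j + 1)) =
      nabla I z + p * (coeff z * A (proj (Nat.le_succ (n + 1)) z)) := by
  rw [nabla, nabla, totalD_add (isOpen_reg n) (fun w hw => differentiableAt_of_reg hI hw) h1 h0 z hz]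
  simp only [coeff, s1_add (by omega : j + 1 ≠ 0), s3_add (by omega : 2 ≤ j + 1)]
  ring

/-- In d the tower is one order lower than its jet order: `s3` contains d undifferentiated, so
`J1root` is free of d'', and each ∇ raises the order by one. -/
theorem nablaIter_J1root_add_three_of_lt {i j : ℕ} (hj : i + 2 ≤ j) :
    ∀ z ∈ Reg (1 + i), ∀ p : ℝ,
      nablaIter J1root i (z + p • unitVec (1 + i + 1) 3 j) = nablaIter J1root i z := by
  rcases hj.eq_or_lt with rfl | hj
  · induction i with
    | zero =>
      intro z hz p
      change J1root (z + p • unitVec (1 + 1) 3 2) = J1root z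
      rw [J1root_eq, J1root_eq, s5_add_three_two, s3_add le_rfl]
    | succ i ih =>
      intro z hz p
      have := nabla_add (A := fun _ => 0) (contDiffOn_nablaIter contDiffOn_J1root i)
        (j := i + 2) (v := 3) (by omega) (fun w hw p => by
          rw [unitVec_eq_zero (by omega), smul_zero, add_zero])
        (fun w hw p => by rw [ih le_rfl w hw]; simp) hz p
      simp only [mul_zero, add_zero] at this
      exact this
  · intro z hz p
    rw [unitVec_eq_zero (by omega), smul_zero, add_zero]

theorem nablaIter_J1root_add_three (i : ℕ) :
    ∀ z ∈ Reg (1 + i), ∀ p : ℝ,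
      nablaIter J1root i (z + p • unitVec (1 + i + 1) 3 (i + 1)) = nablaIter J1root i z +
        p * (coeff z ^ i * (-3 * s1 z ^ 3 / cbrt (s3 z) ^ 5)) := by
  induction i with
  | zero =>
    intro z hz p
    change J1root (z + p • unitVec (1 + 1) 3 1) = J1root z + _
    rw [J1root_eq, J1root_eq, s5_add_three_one, s3_add_three one_ne_zero]
    simp only [pow_zero]
    ring
  | succ i ih =>
    intro z hz p
    have := nabla_add (contDiffOn_nablaIter contDiffOn_J1root i) (by omega)
      (nablaIter_J1root_add_three_of_lt le_rfl) ih hz p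
    simp only [coeff_proj, s1_proj, s3_proj] at this
    refine this.trans ?_
    rw [pow_succ (coeff z) i, mul_comm (coeff z ^ i) (coeff z), mul_assoc (coeff z)]
    rfl

/-- Unlike d, b reaches the full jet order, since b' occurs in `s3`. This leaves a free top
coordinate for `exists_lift`. -/
theorem nablaIter_J1root_add_one (i : ℕ) :
    ∀ z ∈ Reg (1 + i), ∀ p : ℝ,
      nablaIter J1root i (z + p • unitVec (1 + i + 1) 1 (i + 2)) = nablaIter J1root i z +
        p * (coeff z ^ i * (-s1 z ^ 2 / cbrt (s3 z) ^ 5)) := by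
  induction i with
  | zero =>
    intro z hz p
    change J1root (z + p • unitVec (1 + 1) 1 2) = J1root z + _
    rw [J1root_eq, J1root_eq, s5_add_one_two, s3_add le_rfl]
    simp only [pow_zero]
    ring
  | succ i ih =>
    intro z hz p
    have := nabla_add (v := 1) (j := i + 2) (contDiffOn_nablaIter contDiffOn_J1root i) (by omega)
      (fun w hw p => by rw [unitVec_eq_zero (by omega), smul_zero, add_zero]) ih hz p
    simp only [coeff_proj, s1_proj, s3_proj] at this
    refine this.trans ?_
    rw [pow_succ (coeff z) i, mul_comm (coeff z ^ i) (coeff z), mul_assoc (coeff z)]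
    rfl

/-- Through each regular point passes a smooth global section of the tower of `J₁^{1/3}`. -/
theorem exists_section_tower {z₀ : Jet (n + 1)} (hz₀ : z₀ ∈ Reg n) :
    ∃ σ : (Fin n → ℝ) → Jet (n + 1), ContDiff ℝ ∞ σ ∧ σ (tower J1root z₀) = z₀ ∧
      (∀ t, σ t ∈ Reg n) ∧ ∀ t, tower J1root (σ t) = t := by
  -- d', …, d^{(m)} are adjusted one after another. These shifts fix `s1` and `s3`, so every slope
  -- is a constant and the section is global.
  have key : ∀ m ≤ n, ∃ σ : (Fin n → ℝ) → Jet (n + 1), ContDiff ℝ ∞ σ ∧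
      σ (tower J1root z₀) = z₀ ∧ (∀ t, s1 (σ t) = s1 z₀) ∧ (∀ t, s3 (σ t) = s3 z₀) ∧
      ∀ t, ∀ i : Fin n, (i : ℕ) < m → tower J1root (σ t) i = t i := by
    intro m
    induction m with
    | zero =>
      intro _
      exact ⟨fun _ => z₀, contDiff_const, rfl, fun _ => rfl, fun _ => rfl, by simp⟩
    | succ m ih =>
      intro hm
      obtain ⟨σ, h1, h2, h3, h4, h5⟩ := ih (by omega)
      let r : Fin n := ⟨m, hm⟩
      have hreg : ∀ t, σ t ∈ Reg n := fun t => by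
        simp only [Reg, Set.mem_ofPred_eq, h3, h4]; exact hz₀
      set A : ℝ := coeff z₀ ^ m * (-3 * s1 z₀ ^ 3 / cbrt (s3 z₀) ^ 5) with hA
      have hA0 : A ≠ 0 := mul_ne_zero (pow_ne_zero _ (coeff_ne_zero hz₀))
        (div_ne_zero (mul_ne_zero (by norm_num) (pow_ne_zero _ (s1_ne_zero hz₀)))
          (pow_ne_zero _ (cbrt_ne_zero (s3_ne_zero hz₀))))
      have hAσ : ∀ t, coeff (σ t) ^ m * (-3 * s1 (σ t) ^ 3 / cbrt (s3 (σ t)) ^ 5) = A := fun t => by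
        simp only [coeff, h3, h4, hA]
      -- The shift of d^{(m+1)} by error over slope corrects member m of the tower and leaves the
      -- earlier members alone.
      refine ⟨fun t => σ t + ((t r - tower J1root (σ t) r) / A) • unitVec (n + 1) 3 (m + 1),
        ?_, ?_, ?_, ?_, ?_⟩
      · have hK : ContDiff ℝ ∞ fun t => tower J1root (σ t) r := by
          rw [← contDiffOn_univ]
          refine (contDiffOn_nablaIter contDiffOn_J1root m).comp
            ((contDiff_proj _).comp h1).contDiffOn fun t _ => ?_
          exact hreg t
        fun_prop
      · simp [h2]
      · intro t; rw [s1_add (by omega), h3]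
      · intro t; rw [s3_add_three (by omega), h4]
      · intro t i hi
        rcases (Nat.lt_succ_iff.1 hi).lt_or_eq with hi | hi
        · rw [← h5 t i hi]
          simp only [tower, proj_add_smul_unitVec]
          exact nablaIter_J1root_add_three_of_lt (by omega) _ (hreg t) _
        · obtain rfl : i = r := Fin.ext hi
          have := nablaIter_J1root_add_three m (proj (by omega) (σ t)) (hreg t)
            ((t r - tower J1root (σ t) r) / A)
          rw [coeff_proj, s1_proj, s3_proj, hAσ, div_mul_cancel₀ _ hA0] at this
          refine this.trans ?_
          change tower J1root (σ t) r + _ = _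
          ring
  obtain ⟨σ, h1, h2, h3, h4, h5⟩ := key n le_rfl
  refine ⟨σ, h1, h2, fun t => ?_, fun t => funext fun i => h5 t i i.2⟩
  simp only [Reg, Set.mem_ofPred_eq, h3, h4]; exact hz₀

/-- The tower determines the derivatives of `d` up to order `n`, given the other coordinates. -/
theorem eq_of_tower_eq {z z' : Jet (n + 1)} (hz : z ∈ Reg n)
    (h1 : z.1 = z'.1) (h2 : ∀ i, i ≠ 3 → z.2 i = z'.2 i) (h0 : z.2 3 0 = z'.2 3 0)
    (ht : (tower J1root z : Fin n → ℝ) = tower J1root z') :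
    ∀ j : Fin (n + 2), (j : ℕ) ≤ n → z.2 3 j = z'.2 3 j := by
  have key : ∀ m ≤ n, ∀ j : Fin (n + 2), (j : ℕ) ≤ m → z.2 3 j = z'.2 3 j := by
    intro m
    induction m with
    | zero =>
      intro _ j hj
      obtain rfl : j = 0 := Fin.ext (by simpa using hj)
      exact h0
    | succ m ih =>
      intro hm j hj
      rcases hj.lt_or_eq with hj | hj
      · exact ih (by omega) j (by omega)
      have hle : 1 + m + 1 ≤ n + 1 := by omega
      -- Up to order m + 2 the two jets differ only by p in d^{(m+1)} and q in d^{(m+2)}. Member m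
      -- of the tower ignores q, so equality of its values forces p = 0.
      set p := z'.2 3 j - z.2 3 j with hp
      let j' : Fin (n + 2) := ⟨m + 2, by omega⟩
      set q := z'.2 3 j' - z.2 3 j' with hq
      have e : proj hle z' = (proj hle z + p • unitVec _ 3 (m + 1)) + q • unitVec _ 3 (m + 2) := by
        refine Prod.ext ?_ ?_
        · simp [proj, unitVec, h1]
        · funext i l
          rw [add_smul_unitVec_apply, add_smul_unitVec_apply]
          simp only [proj]
          by_cases hi : i = 3
          · subst hi
            have hl := l.2
            rcases lt_trichotomy (l : ℕ) (m + 1) with h | h | h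
            · rw [if_neg (by omega), if_neg (by omega), add_zero, add_zero]
              exact (ih (by omega) _ (by simp; omega)).symm
            · rw [if_pos ⟨rfl, h⟩, if_neg (by omega), add_zero, hp]
              have : Fin.castLE (Nat.succ_le_succ hle) l = j := Fin.ext (by simp [h, hj])
              rw [this]; ring
            · rw [if_neg (by omega), if_pos ⟨rfl, by omega⟩, add_zero, hq]
              have : Fin.castLE (Nat.succ_le_succ hle) l = j' :=
                Fin.ext (by simp [j']; omega)
              rw [this]; ring
          · simp [hi, h2 i hi]
      have t := congrFun ht ⟨m, hm⟩
      change nablaIter J1root m (proj hle z) = nablaIter J1root m (proj hle z') at t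
      rw [e, nablaIter_J1root_add_three_of_lt le_rfl _ (add_mem_reg (by simp) hz p),
        nablaIter_J1root_add_three m _ hz] at t
      have hA0 : coeff (proj hle z) ^ m * (-3 * s1 (proj hle z) ^ 3 / cbrt (s3 (proj hle z)) ^ 5)
          ≠ 0 := mul_ne_zero (pow_ne_zero _ (coeff_ne_zero hz))
        (div_ne_zero (mul_ne_zero (by norm_num) (pow_ne_zero _ (s1_ne_zero hz)))
          (pow_ne_zero _ (cbrt_ne_zero (s3_ne_zero hz))))
      have : p = 0 := by
        exact (mul_eq_zero.1 (left_eq_add.1 t)).resolve_right hA0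
      linarith
  exact key n le_rfl

/-- The top derivative of `b` allows to extend a jet with a prescribed value of the next member
of the tower. -/
theorem exists_lift {z : Jet (n + 1)} (hz : z ∈ Reg n) (r : ℝ) :
    ∃ z' : Jet (n + 1 + 1), proj (Nat.le_succ (n + 1)) z' = z ∧
      tower J1root z' (Fin.last n) = r := by
  obtain ⟨s, -, hs⟩ := exists_jet_eq z
  set y := jet (n + 1 + 1) s z.1 with hy
  have hyz : proj (Nat.le_succ (n + 1)) y = z := hs
  have hle : 1 + n + 1 ≤ n + 1 + 1 := by omega
  have hyr : proj hle y ∈ Reg (1 + n) := by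
    rw [← hyz] at hz; exact hz
  have hB : coeff (proj hle y) ^ n * (-s1 (proj hle y) ^ 2 / cbrt (s3 (proj hle y)) ^ 5) ≠ 0 :=
    mul_ne_zero (pow_ne_zero _ (coeff_ne_zero hyr))
      (div_ne_zero (neg_ne_zero.2 (pow_ne_zero _ (s1_ne_zero hyr)))
        (pow_ne_zero _ (cbrt_ne_zero (s3_ne_zero hyr))))
  set B := coeff (proj hle y) ^ n * (-s1 (proj hle y) ^ 2 / cbrt (s3 (proj hle y)) ^ 5)
  -- b^{(n+2)} lies above the order of z, so shifting it keeps the projection; B is the slope of the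
  -- new member in it.
  refine ⟨y + ((r - nablaIter J1root n (proj hle y)) / B) • unitVec (n + 1 + 1) 1 (n + 2), ?_, ?_⟩
  · rw [proj_add_smul_unitVec, unitVec_eq_zero (by omega), smul_zero, add_zero, hyz]
  · change nablaIter J1root n (proj hle (_ + _)) = r
    rw [proj_add_smul_unitVec, nablaIter_J1root_add_one n _ hyr, div_mul_cancel₀ _ hB]
    ring

end UnitVec

end Abel

/-! ### Composition and inversion, normal form, separation of orbits -/

namespace Abel

namespace Transforms

variable {f g h f₂ g₂ h₂ : ℝ → ℝ} {s s' s'' : ℝ → Fin 4 → ℝ} {x : ℝ}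

theorem trans (T : Transforms f g h s s' x) (T₂ : Transforms f₂ g₂ h₂ s' s'' (f x)) :
    Transforms (fun t => f₂ (f t)) (fun t => g₂ (f t) * g t)
      (fun t => g₂ (f t) * h t + h₂ (f t)) s s'' x := by
  have hd : ∀ {y}, Transforms f g h s s' y → ∀ {w : ℝ → ℝ}, SmoothNear w (f y) →
      HasDerivAt (fun t => w (f t)) (deriv w (f y) * deriv f y) y := fun T w hw =>
    hw.hasDerivAt.comp _ T.smooth_f.hasDerivAt
  refine ⟨T₂.smooth_f.comp T.smooth_f, (T₂.smooth_g.comp T.smooth_f).mul T.smooth_g,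
    ((T₂.smooth_g.comp T.smooth_f).mul T.smooth_h).add (T₂.smooth_h.comp T.smooth_f),
    T.smooth_source, T₂.smooth_target, ?_, mul_ne_zero T₂.scale_ne T.scale_ne, ?_⟩
  · rw [(hd T T₂.smooth_f).deriv]
    exact mul_ne_zero T₂.deriv_ne T.deriv_ne
  · filter_upwards [T.eventually, T.smooth_f.self.continuousAt.eventually T₂.eventually]
      with t ht ht₂ y
    have e := ht.equation.self_of_nhds y
    have e₂ := ht₂.equation.self_of_nhds (g t * y + h t)
    have a1 := (hd ht ht₂.smooth_f).deriv
    have a2 := ((hd ht ht₂.smooth_g).mul ht.smooth_g.hasDerivAt).deriv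
    have a3 := (((hd ht ht₂.smooth_g).mul ht.smooth_h.hasDerivAt).add (hd ht ht₂.smooth_h)).deriv
    have a2' : deriv (fun t => g₂ (f t) * g t) t = _ := a2
    have a3' : deriv (fun t => g₂ (f t) * h t + h₂ (f t)) t = _ := a3
    rw [a1, a2', a3']
    have : g₂ (f t) * g t * y + (g₂ (f t) * h t + h₂ (f t)) =
        g₂ (f t) * (g t * y + h t) + h₂ (f t) := by ring
    rw [this]
    linear_combination g₂ (f t) * e + deriv f t * e₂

theorem symm (T : Transforms f g h s s' x) :
    ∃ f' g' h', Transforms f' g' h' s' s (f x) ∧ f' (f x) = x := by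
  obtain ⟨w, hw, hwx, hwf, hfw⟩ := T.smooth_f.exists_inverse T.deriv_ne
  have hf : SmoothNear f (w (f x)) := by rw [hwx]; exact T.smooth_f
  have hg : SmoothNear g (w (f x)) := by rw [hwx]; exact T.smooth_g
  have hh : SmoothNear h (w (f x)) := by rw [hwx]; exact T.smooth_h
  have hs : SmoothNear s (w (f x)) := by rw [hwx]; exact T.smooth_source
  have hg0 : g (w (f x)) ≠ 0 := by rw [hwx]; exact T.scale_ne
  have h1 : SmoothNear (fun t => 1 / g (w t)) (f x) :=
    (smoothNear_const 1).div (hg.comp hw) hg0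
  have h2 : SmoothNear (fun t => (0 - h (w t)) / g (w t)) (f x) :=
    ((smoothNear_const 0).sub (hh.comp hw)).div (hg.comp hw) hg0
  have hT : ∀ᶠ t in 𝓝 (f x), Transforms f g h s s' (w t) :=
    hw.self.continuousAt.eventually (by rw [hwx]; exact T.eventually)
  have hder : ∀ᶠ t in 𝓝 (f x), deriv f (w t) * deriv w t = 1 := by
    filter_upwards [hw.eventually, eventually_eventually_nhds.2 hfw, hT] with t a b c
    have := (c.smooth_f.hasDerivAt.comp t a.hasDerivAt).congr_of_eventuallyEq
      (f₁ := fun t => t) (by filter_upwards [b] with t ht using ht.symm)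
    exact this.unique (hasDerivAt_id t)
  refine ⟨w, fun t => 1 / g (w t), fun t => (0 - h (w t)) / g (w t),
    ⟨hw, h1, h2, T.smooth_target, hs, ?_, one_div_ne_zero hg0, ?_⟩, hwx⟩
  · exact right_ne_zero_of_mul (hder.self_of_nhds.trans_ne one_ne_zero)
  · filter_upwards [hw.eventually, hfw, hT, hder] with t a b c d y
    have g0 := c.scale_ne
    have f0 := c.deriv_ne
    have dg := c.smooth_g.hasDerivAt.comp t a.hasDerivAt
    have dh := c.smooth_h.hasDerivAt.comp t a.hasDerivAt
    have d1 : deriv (fun t => 1 / g (w t)) t = _ :=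
      ((hasDerivAt_const t (1 : ℝ)).div dg g0).deriv
    have d2 : deriv (fun t => (0 - h (w t)) / g (w t)) t = _ :=
      (((hasDerivAt_const t (0 : ℝ)).sub dh).div dg g0).deriv
    -- The original equation is taken at the preimage (y - h)/g of y.
    have e := c.equation.self_of_nhds (1 / g (w t) * y + (0 - h (w t)) / g (w t))
    have e' : g (w t) * (1 / g (w t) * y + (0 - h (w t)) / g (w t)) + h (w t) = y := by
      field_simp; ring
    rw [e', b] at e
    have dw : deriv w t = 1 / deriv f (w t) := by
      rw [eq_div_iff f0, mul_comm]; exact d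
    rw [d1, d2]
    simp only [Function.comp, Pi.sub_apply, dw]
    have e2 : abel (s' t) y = (deriv g (w t) * (1 / g (w t) * y + (0 - h (w t)) / g (w t)) +
        g (w t) * abel (s (w t)) (1 / g (w t) * y + (0 - h (w t)) / g (w t)) +
        deriv h (w t)) / deriv f (w t) := by
      rw [eq_div_iff f0, e]; ring
    rw [e2]
    field_simp
    ring

end Transforms

/-- The Abel equations `y' = y³ + φ(x)`. -/
def normalForm (φ : ℝ → ℝ) (t : ℝ) : Fin 4 → ℝ := ![1, 0, 0, φ t]

theorem smoothNear_normalForm {φ : ℝ → ℝ} {x : ℝ} (h : SmoothNear φ x) :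
    SmoothNear (normalForm φ) x := by
  rw [smoothNear_pi]
  intro i
  fin_cases i
  · exact smoothNear_const 1
  · exact smoothNear_const 0
  · exact smoothNear_const 0
  · exact h

/-- Near a regular point every Abel equation can be brought to the form `y' = y³ + φ(x)`. -/
theorem exists_normalForm {s : ℝ → Fin 4 → ℝ} {x : ℝ} (hs : SmoothNear s x) {n : ℕ}
    (hz : jet (n + 1) s x ∈ Reg n) :
    ∃ f g h φ, Transforms f g h s (normalForm φ) x ∧ f x = 0 ∧ SmoothNear φ 0 ∧
      φ 0 = -1 / 3 := by
  have ha := smoothNear_pi.1 hs 0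
  have hb := smoothNear_pi.1 hs 1
  have hc := smoothNear_pi.1 hs 2
  have hd := smoothNear_pi.1 hs 3
  have ha0 : s x 0 ≠ 0 := by simpa [s1, jet] using s1_ne_zero hz
  -- The target a = 1, b = c = 0 forces f' = a/g², h = g b/(3a) and g'/g = b²/(3a) - c. The last is
  -- solved by g = g₀ exp p, with p a primitive of this right-hand side.
  have hq : SmoothNear (fun t => s t 1 ^ 2 / (3 * s t 0) - s t 2) x :=
    ((hb.pow 2).div ((smoothNear_const 3).mul ha) (mul_ne_zero three_ne_zero ha0)).sub hc
  obtain ⟨p, hp, hpx, hpd⟩ := hq.exists_primitive 0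
  -- At x one has f'g = a/g₀. This g₀ makes it the cube root of s₃, so that s₃ becomes 1 in the
  -- normal form, where s₃ = -3φ.
  set g₀ := s x 0 / cbrt (s3 (jet (n + 1) s x)) with hg₀
  have hc0 := cbrt_ne_zero (s3_ne_zero hz)
  have hg₀0 : g₀ ≠ 0 := div_ne_zero ha0 hc0
  have hg : SmoothNear (fun t => g₀ * Real.exp (p t)) x := (smoothNear_const g₀).mul hp.exp
  have hg0 : ∀ t, g₀ * Real.exp (p t) ≠ 0 := fun t => mul_ne_zero hg₀0 (Real.exp_ne_zero _)
  set g : ℝ → ℝ := fun t => g₀ * Real.exp (p t) with hgdef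
  have hh : SmoothNear (fun t => g t * s t 1 / (3 * s t 0)) x :=
    (hg.mul hb).div ((smoothNear_const 3).mul ha) (mul_ne_zero three_ne_zero ha0)
  set h : ℝ → ℝ := fun t => g t * s t 1 / (3 * s t 0) with hhdef
  have hfd : SmoothNear (fun t => s t 0 / g t ^ 2) x := ha.div (hg.pow 2) (pow_ne_zero 2 (hg0 x))
  obtain ⟨f, hf, hfx, hfder⟩ := hfd.exists_primitive 0
  have hfder0 : deriv f x ≠ 0 := by
    rw [hfder.self_of_nhds.deriv]
    exact div_ne_zero ha0 (pow_ne_zero 2 (hg0 x))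
  obtain ⟨w, hw, hwx, hwf, hfw⟩ := hf.exists_inverse hfder0
  -- The new d, read off from the y-free part of the transformation law as a function of the old
  -- variable.
  set δ : ℝ → ℝ := fun t => (g t * s t 3 + deriv h t) / deriv f t - h t ^ 3 with hδdef
  have hδ : SmoothNear δ x := (((hg.mul hd).add hh.deriv).div hf.deriv hfder0).sub (hh.pow 3)
  have hφ : SmoothNear (fun t => δ (w t)) (f x) := SmoothNear.comp (by rwa [hwx]) hw
  have T : Transforms f g h s (normalForm fun t => δ (w t)) x := by
    refine ⟨hf, hg, hh, hs, smoothNear_normalForm hφ, hfder0, hg0 x, ?_⟩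
    filter_upwards [hwf, hpd, hfder, hf.deriv.eventually_ne hfder0, ha.eventually_ne ha0]
      with t a b c c0 a0 y
    have dg : deriv g t = _ := (b.exp.const_mul g₀).deriv
    have dg' : deriv g t = g t * (s t 1 ^ 2 / (3 * s t 0) - s t 2) := by
      rw [dg, hgdef]; ring
    have df := c.deriv
    have g0 := hg0 t
    change g t ≠ 0 at g0
    have hD : deriv f t * δ t = g t * s t 3 + deriv h t - deriv f t * h t ^ 3 := by
      rw [hδdef]; field_simp
    simp only [abel, normalForm, Matrix.cons_val_zero, Matrix.cons_val_one, Matrix.cons_val, a]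
    rw [mul_add (deriv f t), hD, dg', df]
    have hht : h t = g t * s t 1 / (3 * s t 0) := rfl
    generalize deriv h t = H at *
    rw [hht]
    field_simp
    ring
  refine ⟨f, g, h, fun t => δ (w t), T, hfx, hfx ▸ hφ, ?_⟩
  have e := T.s3_eq n
  have dfx := hfder.self_of_nhds.deriv
  have hgx : g x = g₀ := by simp [hgdef, hpx]
  have e1 : s3 (jet (n + 1) (normalForm fun t => δ (w t)) (f x)) = -3 * δ (w (f x)) := by
    simp [s3, jet, normalForm]
  rw [e1, dfx, hgx] at e
  rw [← hfx]
  set S := s3 (jet (n + 1) s x) with hS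
  have hr : s x 0 / g₀ ^ 2 * g₀ = cbrt S := by
    rw [hg₀]; field_simp
  rw [hr, cbrt_pow_three] at e
  have hS0 : S ≠ 0 := s3_ne_zero hz
  have := mul_left_cancel₀ hS0 ((mul_one S).trans e)
  linarith

theorem iteratedDeriv_sub_eq_zero {u v : ℝ → ℝ} {x : ℝ} (hu : SmoothNear u x)
    (hv : SmoothNear v x) {j : ℕ} (h : iteratedDeriv j u x = iteratedDeriv j v x) :
    iteratedDeriv j (fun t => u t - v t) x = 0 := by
  have hle : ((j : ℕ∞) : ℕ∞ω) ≤ ∞ := by exact_mod_cast le_top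
  rw [iteratedDeriv_fun_sub (hu.self.of_le hle) (hv.self.of_le hle), h, sub_self]

/-- A change of the function `φ` in a normal form `y' = y³ + φ(x)` of an Abel equation that
vanishes to order `k` can be absorbed by a change of the equation that vanishes to order `k`. -/
theorem Transforms.exists_perturb {f g h φ φ' : ℝ → ℝ} {s : ℝ → Fin 4 → ℝ} {x : ℝ}
    (T : Transforms f g h s (normalForm φ) x) (hφ : SmoothNear φ (f x))
    (hφ' : SmoothNear φ' (f x)) {k : ℕ}
    (hk : ∀ j ≤ k, iteratedDeriv j φ (f x) = iteratedDeriv j φ' (f x)) :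
    ∃ r, Transforms f g h r (normalForm φ') x ∧ jet k r x = jet k s x := by
  -- For fixed f, g, h, the y-free part g d + h' = f' (… + φ ∘ f) shows that a change of φ by δ
  -- changes d by (f'/g) (δ ∘ f).
  set m : ℝ → ℝ := fun t => deriv f t / g t with hmdef
  have hm : SmoothNear m x := T.smooth_f.deriv.div T.smooth_g T.scale_ne
  have hδ : SmoothNear (fun t => φ' t - φ t) (f x) := hφ'.sub hφ
  set ε : ℝ → ℝ := fun t => m t * (φ' (f t) - φ (f t)) with hεdef
  have hε : SmoothNear ε x := hm.mul (hδ.comp T.smooth_f)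
  have hε0 : ∀ j ≤ k, iteratedDeriv j ε x = 0 :=
    iteratedDeriv_mul_comp_eq_zero (δ := fun t => φ' t - φ t) k hm T.smooth_f hδ fun j hj =>
      iteratedDeriv_sub_eq_zero hφ' hφ (hk j hj).symm
  have hs := smoothNear_pi.1 T.smooth_source
  refine ⟨fun t => ![s t 0, s t 1, s t 2, s t 3 + ε t], ⟨T.smooth_f, T.smooth_g, T.smooth_h, ?_,
    smoothNear_normalForm hφ', T.deriv_ne, T.scale_ne, ?_⟩, ?_⟩
  · rw [smoothNear_pi]
    intro i
    fin_cases i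
    · exact hs 0
    · exact hs 1
    · exact hs 2
    · exact (hs 3).add hε
  · filter_upwards [T.equation, T.smooth_g.eventually_ne T.scale_ne] with t ht g0 y
    have e := ht y
    have he : g t * ε t = deriv f t * (φ' (f t) - φ (f t)) := by
      rw [hεdef, hmdef]; field_simp
    simp only [abel, normalForm, Matrix.cons_val_zero, Matrix.cons_val_one, Matrix.cons_val] at e ⊢
    linear_combination e + he
  · refine Prod.ext rfl ?_
    funext i j
    have hle : (((j : ℕ) : ℕ∞) : ℕ∞ω) ≤ ∞ := by exact_mod_cast le_top
    fin_cases i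
    · rfl
    · rfl
    · rfl
    · change iteratedDeriv j (fun t => s t 3 + ε t) x = iteratedDeriv j (fun t => s t 3) x
      rw [iteratedDeriv_fun_add ((hs 3).self.of_le hle) (hε.self.of_le hle), hε0 j (by omega),
        add_zero]

theorem tower_eq_of_sameOrbit {n : ℕ} {z z' : Jet (n + 1)} (hz : z ∈ Reg n) (hz' : z' ∈ Reg n)
    (H : SameOrbit z z') : (tower J1root z : Fin n → ℝ) = tower J1root z' :=
  funext fun i => (lift_mem_invariants _ (nablaIter_mem_invariants J1root_mem_invariants i)).2
    z hz z' hz' H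

/-- The tower of `J₁^{1/3}` separates the regular orbits. -/
theorem sameOrbit_of_tower_eq {n : ℕ} {z z' : Jet (n + 1)} (hz : z ∈ Reg n) (hz' : z' ∈ Reg n)
    (H : (tower J1root z : Fin n → ℝ) = tower J1root z') : SameOrbit z z' := by
  -- The tower of z controls φ only up to order n, while the jets have order n + 1. Lifts with the
  -- same next member supply the missing derivative.
  obtain ⟨y, hy, -⟩ := exists_lift hz 0
  obtain ⟨y', hy', hyt⟩ := exists_lift hz' (tower J1root y (Fin.last n))
  have hyr : y ∈ Reg (n + 1) := by
    rw [← hy] at hz; exact hz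
  have hyr' : y' ∈ Reg (n + 1) := by
    rw [← hy'] at hz'; exact hz'
  have Hy : (tower J1root y : Fin (n + 1) → ℝ) = tower J1root y' := by
    funext i
    refine Fin.lastCases hyt.symm (fun i => ?_) i
    rw [← hy, ← hy'] at H
    exact congrFun H i
  obtain ⟨s, hs, hsy⟩ := exists_jet_eq y
  obtain ⟨s', hs', hsy'⟩ := exists_jet_eq y'
  rw [← hsy] at hyr
  rw [← hsy'] at hyr'
  obtain ⟨f, g, h, φ, T, hf, hφ, hφ0⟩ := exists_normalForm hs hyr
  obtain ⟨f', g', h', φ', T', hf', hφ', hφ0'⟩ := exists_normalForm hs' hyr'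
  have hN := (T.mem_reg_iff (n + 1)).1 hyr
  have hN' := (T'.mem_reg_iff (n + 1)).1 hyr'
  have e := tower_eq_of_sameOrbit hyr hN ⟨f, g, h, s, _, T, rfl, rfl, rfl⟩
  have e' := tower_eq_of_sameOrbit hyr' hN' ⟨f', g', h', s', _, T', rfl, rfl, rfl⟩
  rw [hsy, hf] at e
  rw [hsy', hf'] at e'
  rw [hf] at hN
  have hφφ := eq_of_tower_eq (z := jet (n + 1 + 1) (normalForm φ) 0)
    (z' := jet (n + 1 + 1) (normalForm φ') 0) hN rfl
    (fun i hi => by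
      fin_cases i
      · rfl
      · rfl
      · rfl
      · exact absurd rfl hi)
    (by simp [jet, normalForm, hφ0, hφ0']) (e.symm.trans (Hy.trans e'))
  have hk : ∀ j ≤ n + 1, iteratedDeriv j φ' (f' y'.1) = iteratedDeriv j φ (f' y'.1) := by
    intro j hj
    rw [hf']
    exact (hφφ ⟨j, by omega⟩ hj).symm
  -- The second equation is altered beyond order n + 1 so that its normal form is exactly that of
  -- the first; T followed by the inverse of `Tr` then joins the two jets.
  obtain ⟨r, Tr, hr⟩ := T'.exists_perturb (hf' ▸ hφ') (hf' ▸ hφ) hk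
  obtain ⟨F, G, K, Ti, hF⟩ := Tr.symm
  rw [hf', ← hf] at Ti
  rw [hf', ← hf] at hF
  have hx : z.1 = y.1 := by rw [← hy]; rfl
  have hx' : z'.1 = y'.1 := by rw [← hy']; rfl
  refine ⟨_, _, _, s, r, hx ▸ T.trans Ti, ?_, ?_, ?_⟩
  · rw [hx, hx', hF]
  · rw [hx, ← hy, ← hsy]; rfl
  · rw [hx', hr, ← hy', ← hsy']; rfl

end Abel

/-! ### Invariants as functions of the tower -/

namespace Abel

variable {n : ℕ}

/-- Invariants are smooth functions of the tower of `J₁^{1/3}`. -/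
theorem exists_eq_comp_tower_J1root {U : Set (Jet (n + 1))} (hU : IsOpen U) (hUr : U ⊆ Reg n)
    {I : Jet (n + 1) → ℝ} (hI : I ∈ invariants U) :
    ∃ F : (Fin n → ℝ) → ℝ, ContDiffOn ℝ ∞ F (tower J1root '' U) ∧
      ∀ z ∈ U, I z = F (tower J1root z) := by
  classical
  -- The value is independent of the chosen point because equal towers mean equal orbits; 0 is a
  -- filler off the image.
  let F : (Fin n → ℝ) → ℝ := fun t =>
    if h : ∃ z ∈ U, tower J1root z = t then I h.choose else 0
  have hF : ∀ z ∈ U, F (tower J1root z) = I z := by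
    intro z hz
    have h : ∃ z' ∈ U, (tower J1root z' : Fin n → ℝ) = tower J1root z := ⟨z, hz, rfl⟩
    simp only [F, dif_pos h]
    exact hI.2 _ h.choose_spec.1 _ hz
      (sameOrbit_of_tower_eq (hUr h.choose_spec.1) (hUr hz) h.choose_spec.2)
  refine ⟨F, ?_, fun z hz => (hF z hz).symm⟩
  rintro _ ⟨z, hz, rfl⟩
  -- Near the tower of z, F coincides with I along a section through z, hence is smooth.
  obtain ⟨σ, hσ, hσz, -, hσt⟩ := exists_section_tower (hUr hz)
  have hmem : ∀ᶠ t in 𝓝 (tower J1root z), σ t ∈ U :=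
    hσ.continuous.continuousAt.eventually (hU.mem_nhds (by rwa [hσz]))
  have hIσ : ContDiffAt ℝ ∞ (fun t => I (σ t)) (tower J1root z) :=
    ContDiffAt.comp _ (hI.1.contDiffAt (hU.mem_nhds (by rwa [hσz]))) hσ.contDiffAt
  refine (hIσ.congr_of_eventuallyEq ?_).contDiffWithinAt
  filter_upwards [hmem] with t ht
  rw [← hF _ ht, hσt]

/-- Makes F smooth on the whole of ℝⁿ, as `Generated.comp` needs a globally continuous function. The
base point of the section is a jet of y' = y³ + 1. -/
theorem image_tower_J1root : (tower J1root '' Reg n : Set (Fin n → ℝ)) = Set.univ := by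
  have hz : (((0 : ℝ), fun (i : Fin 4) (j : Fin (n + 1 + 1)) =>
      if j = 0 ∧ (i = 0 ∨ i = 3) then (1 : ℝ) else 0) : Jet (n + 1)) ∈ Reg n := by
    simp [Reg, s1, s3]
  obtain ⟨σ, -, -, h1, h2⟩ := exists_section_tower hz
  exact Set.eq_univ_of_forall fun t => ⟨σ t, h1 t, h2 t⟩

theorem mem_invariants_iff_generated {I : Jet (n + 1) → ℝ} :
    I ∈ invariants (Reg n) ↔ Generated n I := by
  refine ⟨fun hI => ?_, Generated.mem_invariants⟩
  obtain ⟨F, hF, hIF⟩ := exists_eq_comp_tower_J1root (isOpen_reg n) subset_rfl hI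
  rw [image_tower_J1root, contDiffOn_univ] at hF
  exact Generated.comp (fun (i : Fin n) z => tower J1root z i) F I
    (fun i => Generated.lift (by omega) (generated_J1root.nablaIter i)) hF.continuous hI.1 hIF

/-- Where `J₁ ≠ 0`, the invariants `∇ⁱ(J₁^{1/3})` are smooth functions of `J₁, …, ∇ⁱJ₁`. -/
theorem exists_nablaIter_J1root_eq (i : ℕ) :
    ∃ Φ : (Fin (i + 1) → ℝ) → ℝ, ContDiffOn ℝ ∞ Φ {t | t 0 ≠ 0} ∧
      ∀ z ∈ Reg (1 + i), J1 (proj (by omega) z) ≠ 0 →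
        nablaIter J1root i z =
          Φ fun j => nablaIter J1 j (proj (by omega : 1 + (j : ℕ) + 1 ≤ 1 + i + 1) z) := by
  induction i with
  | zero =>
    refine ⟨fun t => cbrt (t 0), fun t ht => ?_, fun z _ _ => rfl⟩
    exact ((contDiffAt_cbrt ht).comp t (contDiff_apply ℝ ℝ 0).contDiffAt).contDiffWithinAt
  | succ i ih =>
    obtain ⟨Φ, hΦ, hi⟩ := ih
    have ho : IsOpen {t : Fin (i + 1) → ℝ | t 0 ≠ 0} :=
      isOpen_ne_fun (continuous_apply 0) continuous_const
    -- Chain rule: ∇(Φ(J₁, …, ∇ⁱJ₁)) is dΦ applied to (∇J₁, …, ∇^{i+1}J₁).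
    refine ⟨fun t => fderiv ℝ Φ (fun j => t j.castSucc) (fun j => t j.succ), ?_, ?_⟩
    · refine ContDiffOn.clm_apply ?_ (by fun_prop)
      refine (hΦ.fderiv_of_isOpen ho (by simp)).comp (t := {t | t 0 ≠ 0}) (by fun_prop) ?_
      exact fun t ht => ht
    · intro z hz h0
      obtain ⟨s, hs, hsz⟩ := exists_jet_eq z
      rw [← hsz] at hz h0 ⊢
      set x := z.1
      have hw : jet (1 + i + 1) s x ∈ Reg (1 + i) := hz
      have h0w : J1 (jet (1 + 1) s x) ≠ 0 := h0
      have hw1 : jet (1 + 1) s x ∈ Reg 1 := hz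
      -- J₁ ≠ 0 is an open condition, so the relation holds along the section near x and can be
      -- differentiated.
      have ev : ∀ᶠ t in 𝓝 x, nablaIter J1root i (jet (1 + i + 1) s t) =
          Φ fun j : Fin (i + 1) => nablaIter J1 j (jet (1 + (j : ℕ) + 1) s t) := by
        have c1 := (hasDerivAt_jet hs (1 + i + 1)).continuousAt.eventually
          ((isOpen_reg (1 + i)).mem_nhds hw)
        have c2 : ContinuousAt (fun t => J1 (jet (1 + 1) s t)) x :=
          (hasDerivAt_comp_jet hs (differentiableAt_of_reg contDiffOn_J1 hw1)).continuousAt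
        filter_upwards [c1, c2.eventually_ne h0w] with t ht ht0
        exact hi _ ht ht0
      have e : nablaIter J1root (i + 1) (jet (1 + (i + 1) + 1) s x) = _ :=
        nabla_jet (contDiffOn_nablaIter contDiffOn_J1root i) hs hw
      have hT : HasDerivAt
          (fun t => fun j : Fin (i + 1) => nablaIter J1 j (jet (1 + (j : ℕ) + 1) s t))
          (fun j => totalD (nablaIter J1 j) (jet (1 + (j : ℕ) + 1 + 1) s x)) x := by
        rw [hasDerivAt_pi]
        exact fun j => hasDerivAt_comp_jet hs
          (differentiableAt_of_reg (contDiffOn_nablaIter contDiffOn_J1 j) hz)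
      have hΦx : DifferentiableAt ℝ Φ
          fun j : Fin (i + 1) => nablaIter J1 j (jet (1 + (j : ℕ) + 1) s x) :=
        (hΦ.contDiffAt (ho.mem_nhds h0w)).differentiableAt (by simp)
      have hd := hΦx.hasFDerivAt.comp_hasDerivAt x hT
      have hd' := (hd.congr_of_eventuallyEq ev).deriv
      rw [e, hd', ← smul_eq_mul, ← map_smul]
      rfl

/-- Where `J₁ ≠ 0`, invariants are smooth functions of the tower of `J₁`. -/
theorem exists_eq_comp_tower_J1 {U : Set (Jet (n + 1))} (hU : IsOpen U) (hUr : U ⊆ Reg n)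
    (h0 : ∀ hn : 1 ≤ n, ∀ z ∈ U, J1 (proj (Nat.succ_le_succ hn) z) ≠ 0)
    {I : Jet (n + 1) → ℝ} (hI : I ∈ invariants U) :
    ∃ F : (Fin n → ℝ) → ℝ, ContDiffOn ℝ ∞ F (tower J1 '' U) ∧
      ∀ z ∈ U, I z = F (tower J1 z) := by
  obtain ⟨F, hF, hIF⟩ := exists_eq_comp_tower_J1root hU hUr hI
  choose Φ hΦ hΦe using exists_nablaIter_J1root_eq
  let Ψ : (Fin n → ℝ) → Fin n → ℝ := fun t i =>
    Φ i fun j => t (Fin.castLE (Nat.succ_le_of_lt i.2) j)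
  have hΨ : ∀ z ∈ U, Ψ (tower J1 z) = tower J1root z := fun z hz => funext fun i =>
    (hΦe i (proj (by omega) z) (hUr hz) (h0 i.pos z hz)).symm
  refine ⟨fun t => F (Ψ t), hF.comp ?_ ?_, fun z hz =>
    (hIF z hz).trans (congrArg F (hΨ z hz).symm)⟩
  · rw [contDiffOn_pi]
    intro i
    refine (hΦ i).comp (by fun_prop) ?_
    rintro _ ⟨z, hz, rfl⟩
    exact h0 i.pos z hz
  · rintro _ ⟨z, hz, rfl⟩
    exact ⟨z, hz, (hΨ z hz).symm⟩

theorem sameOrbit_iff_invariants_eq {z z' : Jet (n + 1)} (hz : z ∈ Reg n) (hz' : z' ∈ Reg n) :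
    SameOrbit z z' ↔ ∀ I ∈ invariants (Reg n), I z = I z' :=
  ⟨fun H _ hI => hI.2 z hz z' hz' H, fun H => sameOrbit_of_tower_eq hz hz' <| funext fun i =>
    H _ (lift_mem_invariants (by omega) (nablaIter_mem_invariants J1root_mem_invariants i))⟩

end Abel

theorem theorem2 :
    -- `∇` is an invariant derivation
    Abel.IsInvariantDerivation Abel.coeff ∧
    -- the algebra of differential invariants is generated by `J₁` and `∇`
    (∀ (n : ℕ) (I : Abel.Jet (n + 1) → ℝ),
      I ∈ Abel.invariants (Abel.Reg n) ↔ Abel.Generated n I) ∧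
    -- where `J₁ ≠ 0`, invariants of order `≤ n + 1` are smooth functions of
    -- `J₁, ∇J₁, …, ∇^{n-1}J₁`
    (∀ (n : ℕ) (U : Set (Abel.Jet (n + 1))), IsOpen U → U ⊆ Abel.Reg n →
      (∀ (hn : 1 ≤ n), ∀ z ∈ U, Abel.J1 (Abel.proj (Nat.succ_le_succ hn) z) ≠ 0) →
      ∀ I ∈ Abel.invariants U, ∃ F : (Fin n → ℝ) → ℝ,
        ContDiffOn ℝ ∞ F (Abel.tower Abel.J1 '' U) ∧ ∀ z ∈ U, I z = F (Abel.tower Abel.J1 z)) ∧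
    -- near all regular points, they are smooth functions of
    -- `J₁^{1/3}, ∇(J₁^{1/3}), …, ∇^{n-1}(J₁^{1/3})`
    (∀ (n : ℕ) (U : Set (Abel.Jet (n + 1))), IsOpen U → U ⊆ Abel.Reg n →
      ∀ I ∈ Abel.invariants U, ∃ F : (Fin n → ℝ) → ℝ,
        ContDiffOn ℝ ∞ F (Abel.tower Abel.J1root '' U) ∧
          ∀ z ∈ U, I z = F (Abel.tower Abel.J1root z)) ∧
    -- the algebra separates regular orbits
    (∀ (n : ℕ), ∀ z ∈ Abel.Reg n, ∀ z' ∈ Abel.Reg n,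
      (Abel.SameOrbit z z' ↔ ∀ I ∈ Abel.invariants (Abel.Reg n), I z = I z')) := by
  exact ⟨Abel.isInvariantDerivation_coeff, fun _ _ => Abel.mem_invariants_iff_generated,
    fun _ _ hU hUr h0 _ hI => Abel.exists_eq_comp_tower_J1 hU hUr h0 hI,
    fun _ _ hU hUr _ hI => Abel.exists_eq_comp_tower_J1root hU hUr hI,
    fun _ _ hz _ hz' => Abel.sameOrbit_iff_invariants_eq hz hz'⟩
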